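/- Fix standard bases of $\mathbb{C}^{d_1}$ and $\mathbb{C}^{d_2}$. For an operator $X$ on $\mathbb{C}^{d_1}\otimes\mathbb{C}^{d_2}$ let $X^\Gamma$ denote the partial transpose on the first tensor factor. A density operator $\rho$ is NPT if $\rho^\Gamma\not\geq0$. A positive operator is separable if it is a finite sum $\sum_i\tau_i\otimes\omega_i$ with $\tau_i,\omega_i\geq 0$; a density operator that is not separable is entangled. A completely positive map $\Lambda$ from the operators on $\mathcal{H}_{A_1}\otimes\mathcal{H}_{B_1}$ to those on $\mathcal{H}_{A_2}\otimes\mathcal{H}_{B_2}$ is non-entangling if it maps separable operators to separable operators; it is dually non-entangling if both $\Lambda$ and its dual map $\Lambda^*$ (defined by $\mathrm{Tr}(\Lambda(X)Y)=\mathrm{Tr}(X\Lambda^*(Y))$ for all $X,Y$) are non-entangling; it is PPT if its Choi operator $J(\Lambda)=\sum_{i,j}\Lambda(|i\rangle\langle j|)\otimes|i\rangle\langle j|$ has a positive semidefinite partial transpose with respect to the cut $A_2A_1:B_2B_1$. A channel is a completely positive trace-preserving linear map. Let $|\phi_2^+\rangle=\frac{1}{\sqrt2}(|11\rangle+|22\rangle)$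 and $\phi_2^+=|\phi_2^+\rangle\langle\phi_2^+|$. A bipartite state $\omega$ is LOCC-distillable if there are channels $\Lambda_n$, each implementable by finitely many rounds of local operations and classical communication, with $\lim_{n\to\infty}\lVert\Lambda_n(\omega^{\otimes n})-\phi_2^+\rVert_1=0$, where $\lVert\cdot\rVert_1$ is the trace norm. **Theorem.** Every NPT state $\rho$ on $\mathbb{C}^{d_1}\otimes\mathbb{C}^{d_2}$ can be mapped, by a channel that is both dually non-entangling and PPT, to an entangled two-qubit state, which is LOCC-distillable. More precisely, $\rho^\Gamma$ has a unit eigenvector with a negative eigenvalue, and for every such unit eigenvector $|\eta\rangle$, with $W=|\eta\rangle\langle\eta|^\Gamma$ and $A=\frac13(W+2\cdot\mathbb{1})$, the map $$\Lambda(X)=\mathrm{Tr}(AX)\,\tfrac14\mathbb{1}_4+\mathrm{Tr}((\mathbb{1}-A)X)\,\phi_2^+$$ is a channel that is both dually non-entangling and PPT, and $\Lambda(\rho)$ is an entangled two-qubit state that is LOCC-distillable. -/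

import Mathlib

open Matrix Filter Topology
open scoped Kronecker TensorProduct ComplexOrder

noncomputable section

namespace QEnt

/-- Density operators: positive semidefinite with trace one. -/
def IsState {d : Type*} [Fintype d] (ρ : Matrix d d ℂ) : Prop :=
  ρ.PosSemidef ∧ ρ.trace = 1

/-- A positive operator on `ℂ^a ⊗ ℂ^b` is separable if it is a finite sum of tensor products of
positive operators. -/
def IsSeparable {a b : Type*} (σ : Matrix (a × b) (a × b) ℂ) : Prop :=
  ∃ (n : ℕ) (τ : Fin n → Matrix a a ℂ) (ω : Fin n → Matrix b b ℂ),
    (∀ i, (τ i).PosSemidef) ∧ (∀ i, (ω i).PosSemidef) ∧ σ = ∑ i, τ i ⊗ₖ ω i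

/-- An entangled state is a density operator which is not separable. -/
def IsEntangledState {a b : Type*} [Fintype a] [Fintype b]
    (ρ : Matrix (a × b) (a × b) ℂ) : Prop :=
  IsState ρ ∧ ¬ IsSeparable ρ

/-- The partial transpose `X^Γ` on the first tensor factor, in the standard basis. -/
def partialTranspose {a b : Type*} (X : Matrix (a × b) (a × b) ℂ) : Matrix (a × b) (a × b) ℂ :=
  Matrix.of fun p q => X (q.1, p.2) (p.1, q.2)

/-- An NPT state is a density operator whose partial transpose is not positive semidefinite. -/
def IsNPTState {a b : Type*} [Fintype a] [Fintype b]
    (ρ : Matrix (a × b) (a × b) ℂ) : Prop :=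
  IsState ρ ∧ ¬ (partialTranspose ρ).PosSemidef

/-- The tensor product `Φ ⊗ Ψ` of two linear maps between spaces of operators, acting on the
operators on the tensor product space. -/
def tensorMap {a b a' b' : Type*} [Fintype a] [DecidableEq a] [Fintype b] [DecidableEq b]
    [Fintype a'] [DecidableEq a'] [Fintype b'] [DecidableEq b']
    (Φ : Matrix a a ℂ →ₗ[ℂ] Matrix a' a' ℂ) (Ψ : Matrix b b ℂ →ₗ[ℂ] Matrix b' b' ℂ) :
    Matrix (a × b) (a × b) ℂ →ₗ[ℂ] Matrix (a' × b') (a' × b') ℂ :=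
  (kroneckerLinearEquiv a' a' b' b' ℂ).toLinearMap ∘ₗ TensorProduct.map Φ Ψ ∘ₗ
    (kroneckerLinearEquiv a a b b ℂ).symm.toLinearMap

/-- The defining property of the tensor product of two maps. -/
theorem tensorMap_kronecker {a b a' b' : Type*} [Fintype a] [DecidableEq a] [Fintype b]
    [DecidableEq b] [Fintype a'] [DecidableEq a'] [Fintype b'] [DecidableEq b']
    (Φ : Matrix a a ℂ →ₗ[ℂ] Matrix a' a' ℂ) (Ψ : Matrix b b ℂ →ₗ[ℂ] Matrix b' b' ℂ)
    (X : Matrix a a ℂ) (Y : Matrix b b ℂ) :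
    tensorMap Φ Ψ (X ⊗ₖ Y) = Φ X ⊗ₖ Ψ Y := by
  simp [tensorMap]

/-- Complete positivity: `id_k ⊗ Φ` preserves positive semidefiniteness for every ancilla `ℂ^k`. -/
def IsCompletelyPositive {d d' : Type*} [Fintype d] [DecidableEq d] [Fintype d'] [DecidableEq d']
    (Φ : Matrix d d ℂ →ₗ[ℂ] Matrix d' d' ℂ) : Prop :=
  ∀ (k : ℕ) (M : Matrix (Fin k × d) (Fin k × d) ℂ), M.PosSemidef →
    (tensorMap (LinearMap.id : Matrix (Fin k) (Fin k) ℂ →ₗ[ℂ] Matrix (Fin k) (Fin k) ℂ) Φ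
      M).PosSemidef

/-- Trace preservation. -/
def IsTracePreserving {d d' : Type*} [Fintype d] [Fintype d']
    (Φ : Matrix d d ℂ →ₗ[ℂ] Matrix d' d' ℂ) : Prop :=
  ∀ X, (Φ X).trace = X.trace

/-- A quantum channel is a completely positive trace-preserving linear map. -/
def IsChannel {d d' : Type*} [Fintype d] [DecidableEq d] [Fintype d'] [DecidableEq d']
    (Φ : Matrix d d ℂ →ₗ[ℂ] Matrix d' d' ℂ) : Prop :=
  IsCompletelyPositive Φ ∧ IsTracePreserving Φ

/-- The dual map `Λ^*`, i.e. the unique linear map with `Tr(Λ(X) Y) = Tr(X Λ^*(Y))` for all `X, Y`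
(see `trace_dualMap`). -/
def dualMap {d d' : Type*} [DecidableEq d] [Fintype d']
    (Φ : Matrix d d ℂ →ₗ[ℂ] Matrix d' d' ℂ) : Matrix d' d' ℂ →ₗ[ℂ] Matrix d d ℂ where
  toFun Y := Matrix.of fun i j => (Φ (Matrix.single j i 1) * Y).trace
  map_add' Y Z := by ext i j; simp [mul_add]
  map_smul' c Y := by ext i j; simp

/-- The property which characterises the dual map. -/
theorem trace_dualMap {d d' : Type*} [Fintype d] [DecidableEq d] [Fintype d']
    (Φ : Matrix d d ℂ →ₗ[ℂ] Matrix d' d' ℂ) (X : Matrix d d ℂ) (Y : Matrix d' d' ℂ) :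
    (Φ X * Y).trace = (X * dualMap Φ Y).trace := by
  induction X using Matrix.induction_on' with
  | h_zero => simp
  | h_add p q hp hq => simp [add_mul, hp, hq]
  | h_std_basis i j x =>
    have h : Matrix.single i j x = x • Matrix.single i j (1 : ℂ) := by simp
    rw [h, map_smul, smul_mul_assoc, smul_mul_assoc, trace_smul, trace_smul]
    congr 1
    simp [Matrix.trace_single_mul, dualMap]

/-- The Choi representation `J(Λ) = (Λ ⊗ id)(∑ᵢⱼ |i⟩⟨j| ⊗ |i⟩⟨j|)`. -/
def choi {d d' : Type*} [Fintype d] [DecidableEq d]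
    (Φ : Matrix d d ℂ →ₗ[ℂ] Matrix d' d' ℂ) : Matrix (d' × d) (d' × d) ℂ :=
  ∑ i, ∑ j, Φ (Matrix.single i j 1) ⊗ₖ Matrix.single i j 1

/-- Regrouping of an operator on `(A₂ ⊗ B₂) ⊗ (A₁ ⊗ B₁)` as one on `(A₂ ⊗ A₁) ⊗ (B₂ ⊗ B₁)`. -/
def regroup {a₂ b₂ a₁ b₁ : Type*} (J : Matrix ((a₂ × b₂) × (a₁ × b₁)) ((a₂ × b₂) × (a₁ × b₁)) ℂ) :
    Matrix ((a₂ × a₁) × (b₂ × b₁)) ((a₂ × a₁) × (b₂ × b₁)) ℂ :=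
  Matrix.reindex (Equiv.prodProdProdComm a₂ b₂ a₁ b₁) (Equiv.prodProdProdComm a₂ b₂ a₁ b₁) J

/-- A PPT map is a completely positive map whose Choi representation has a positive partial
transpose with respect to the cut `A₂A₁ : B₂B₁`. -/
def IsPPTMap {a₁ b₁ a₂ b₂ : Type*} [Fintype a₁] [DecidableEq a₁] [Fintype b₁] [DecidableEq b₁]
    [Fintype a₂] [DecidableEq a₂] [Fintype b₂] [DecidableEq b₂]
    (Λ : Matrix (a₁ × b₁) (a₁ × b₁) ℂ →ₗ[ℂ] Matrix (a₂ × b₂) (a₂ × b₂) ℂ) : Prop :=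
  IsCompletelyPositive Λ ∧ (partialTranspose (regroup (choi Λ))).PosSemidef

/-- A non-entangling (separable-preserving) map is a completely positive map which sends separable
operators to separable operators. -/
def IsNonEntangling {a₁ b₁ a₂ b₂ : Type*} [Fintype a₁] [DecidableEq a₁] [Fintype b₁]
    [DecidableEq b₁] [Fintype a₂] [DecidableEq a₂] [Fintype b₂] [DecidableEq b₂]
    (Λ : Matrix (a₁ × b₁) (a₁ × b₁) ℂ →ₗ[ℂ] Matrix (a₂ × b₂) (a₂ × b₂) ℂ) : Prop :=
  IsCompletelyPositive Λ ∧ ∀ σ, IsSeparable σ → IsSeparable (Λ σ)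

/-- A map is dually non-entangling if the map and its dual are both non-entangling. -/
def IsDuallyNonEntangling {a₁ b₁ a₂ b₂ : Type*} [Fintype a₁] [DecidableEq a₁] [Fintype b₁]
    [DecidableEq b₁] [Fintype a₂] [DecidableEq a₂] [Fintype b₂] [DecidableEq b₂]
    (Λ : Matrix (a₁ × b₁) (a₁ × b₁) ℂ →ₗ[ℂ] Matrix (a₂ × b₂) (a₂ × b₂) ℂ) : Prop :=
  IsNonEntangling Λ ∧ IsNonEntangling (dualMap Λ)

/-- A (finite) quantum instrument: completely positive maps, indexed by the measurement outcomes,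
whose sum is trace preserving. -/
def IsInstrument {d d' ι : Type*} [Fintype d] [DecidableEq d] [Fintype d'] [DecidableEq d']
    [Fintype ι] (E : ι → (Matrix d d ℂ →ₗ[ℂ] Matrix d' d' ℂ)) : Prop :=
  (∀ x, IsCompletelyPositive (E x)) ∧ IsTracePreserving (∑ x, E x)

/-- Channels implementable by local operations and classical communication in finitely many rounds.
Either both parties apply local channels and stop, or one of the parties performs a local
instrument and broadcasts the outcome `x`, after which the parties continue with an LOCC protocol
that may depend on `x`. -/
inductive IsLOCC {a' b' : Type} [Fintype a'] [DecidableEq a'] [Fintype b'] [DecidableEq b'] :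
    ∀ {a b : Type} [Fintype a] [DecidableEq a] [Fintype b] [DecidableEq b],
      (Matrix (a × b) (a × b) ℂ →ₗ[ℂ] Matrix (a' × b') (a' × b') ℂ) → Prop
  | localOps {a b : Type} [Fintype a] [DecidableEq a] [Fintype b] [DecidableEq b]
      (Φ : Matrix a a ℂ →ₗ[ℂ] Matrix a' a' ℂ) (Ψ : Matrix b b ℂ →ₗ[ℂ] Matrix b' b' ℂ)
      (hΦ : IsChannel Φ) (hΨ : IsChannel Ψ) : IsLOCC (tensorMap Φ Ψ)
  | alice {a b c ι : Type} [Fintype a] [DecidableEq a] [Fintype b] [DecidableEq b]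
      [Fintype c] [DecidableEq c] [Fintype ι]
      (E : ι → (Matrix a a ℂ →ₗ[ℂ] Matrix c c ℂ)) (hE : IsInstrument E)
      (Λ : ι → (Matrix (c × b) (c × b) ℂ →ₗ[ℂ] Matrix (a' × b') (a' × b') ℂ))
      (hΛ : ∀ x, IsLOCC (Λ x)) :
      IsLOCC (∑ x, Λ x ∘ₗ tensorMap (E x) (LinearMap.id : Matrix b b ℂ →ₗ[ℂ] Matrix b b ℂ))
  | bob {a b c ι : Type} [Fintype a] [DecidableEq a] [Fintype b] [DecidableEq b]
      [Fintype c] [DecidableEq c] [Fintype ι]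
      (E : ι → (Matrix b b ℂ →ₗ[ℂ] Matrix c c ℂ)) (hE : IsInstrument E)
      (Λ : ι → (Matrix (a × c) (a × c) ℂ →ₗ[ℂ] Matrix (a' × b') (a' × b') ℂ))
      (hΛ : ∀ x, IsLOCC (Λ x)) :
      IsLOCC (∑ x, Λ x ∘ₗ tensorMap (LinearMap.id : Matrix a a ℂ →ₗ[ℂ] Matrix a a ℂ) (E x))

/-- The state vector `|φ_d⁺⟩ = d^{-1/2} ∑ᵢ |ii⟩`. -/
def phiPlusVec (d : ℕ) : Fin d × Fin d → ℂ :=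
  fun p => if p.1 = p.2 then ((1 / Real.sqrt d : ℝ) : ℂ) else 0

/-- The maximally entangled state `φ_d⁺ = |φ_d⁺⟩⟨φ_d⁺|`. -/
def phiPlus (d : ℕ) : Matrix (Fin d × Fin d) (Fin d × Fin d) ℂ :=
  vecMulVec (phiPlusVec d) (star (phiPlusVec d))

/-- The trace norm: the sum of the singular values. -/
def traceNorm {d : Type*} [Fintype d] [DecidableEq d] (X : Matrix d d ℂ) : ℝ :=
  ∑ i, Real.sqrt ((isHermitian_conjTranspose_mul_self X).eigenvalues i)

/-- The tensor power `ρ^{⊗n}`, as an operator on `A^{⊗n} ⊗ B^{⊗n}`. -/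
def tensorPower {a b : Type*} (ρ : Matrix (a × b) (a × b) ℂ) (n : ℕ) :
    Matrix ((Fin n → a) × (Fin n → b)) ((Fin n → a) × (Fin n → b)) ℂ :=
  Matrix.of fun p q => ∏ k, ρ (p.1 k, p.2 k) (q.1 k, q.2 k)

/-- A bipartite state `ρ` is LOCC-distillable if there are LOCC channels `Λₙ` for which
`Λₙ(ρ^{⊗n})` converges to the two-qubit maximally entangled state in trace norm. -/
def IsLOCCDistillable {a b : Type} [Fintype a] [DecidableEq a] [Fintype b] [DecidableEq b]
    (ρ : Matrix (a × b) (a × b) ℂ) : Prop :=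
  ∃ Λ : ∀ n : ℕ, (Matrix ((Fin n → a) × (Fin n → b)) ((Fin n → a) × (Fin n → b)) ℂ →ₗ[ℂ]
      Matrix (Fin 2 × Fin 2) (Fin 2 × Fin 2) ℂ),
    (∀ n, IsLOCC (Λ n)) ∧
      Tendsto (fun n => traceNorm (Λ n (tensorPower ρ n) - phiPlus 2)) atTop (𝓝 0)

/-- `η` is a unit vector which is an eigenvector of `M` with a negative eigenvalue. -/
def IsNegativeUnitEigenvector {d : Type*} [Fintype d] (M : Matrix d d ℂ) (η : d → ℂ) : Prop :=
  star η ⬝ᵥ η = 1 ∧ ∃ μ : ℝ, μ < 0 ∧ M *ᵥ η = (μ : ℂ) • η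

/-- The operator `W = |η⟩⟨η|^Γ`. -/
def witness {a b : Type*} (η : a × b → ℂ) : Matrix (a × b) (a × b) ℂ :=
  partialTranspose (vecMulVec η (star η))

/-- The operator `A = (W + 2 𝟙) / 3`. -/
def testOperator {a b : Type*} [DecidableEq a] [DecidableEq b] (η : a × b → ℂ) :
    Matrix (a × b) (a × b) ℂ :=
  (1 / 3 : ℂ) • (witness η + (2 : ℂ) • (1 : Matrix (a × b) (a × b) ℂ))

/-- The map `Λ(X) = Tr(A X) 𝟙₄/4 + Tr((𝟙 - A) X) φ₂⁺` into the operators on two qubits. -/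
def measurePrepare {d : Type*} [Fintype d] [DecidableEq d] (A : Matrix d d ℂ) :
    Matrix d d ℂ →ₗ[ℂ] Matrix (Fin 2 × Fin 2) (Fin 2 × Fin 2) ℂ where
  toFun X := (A * X).trace • ((1 / 4 : ℂ) • (1 : Matrix (Fin 2 × Fin 2) (Fin 2 × Fin 2) ℂ)) +
    ((1 - A) * X).trace • phiPlus 2
  map_add' X Y := by simp only [mul_add, trace_add]; module
  map_smul' c X := by
    simp only [Matrix.mul_smul, trace_smul, RingHom.id_apply, smul_eq_mul]; module

end QEnt

end

open QEnt

noncomputable section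

namespace QEnt

/-! ### Separable operators -/

/-! With `P = |η⟩⟨η|`, the witness satisfies `Tr(Wρ) = ⟨η|ρ^Γ|η⟩ = μ < 0`, while `Tr(Wσ) ≥ 0` for
separable `σ`, whose partial transpose is again separable. The map measures the effect `A` and
prepares white noise or `φ₂⁺`, so its output is the isotropic operator `x𝟙 + 2yφ₂⁺`. On `ρ` one gets
`x = (μ+2)/12` and `y = (1-μ)/6`, hence `y - x = -μ/4 > 0`: just past the separability threshold `x
= y`.

The structural properties rest on two facts. First, `2𝟙 ± P` is separable
(`isSeparable_two_add_smul_rank_one`), hence so is `2𝟙 ± W`; this makes `A` separable and handles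
the dual map. Second, `W ≤ 𝟙` (`posSemidef_one_sub_witness`), so `A` is a valid effect. The map
itself preserves separability because `𝟙 + 2φ₂⁺` is separable, and the PPT property follows by
diagonalising the swap `2φ₂⁺^Γ`.

Distillability of isotropic states with `x < y` is proved with one explicit filter, `codeFilter`,
which projects many copies onto a concatenated repetition code. Its output entries are computed
exactly; the inner length `n` suppresses one kind of error through `(x/y)^n`, and the outer length
`m` suppresses the other (`exists_code_parameters`). The filter succeeds with some fixed positive
probability, so repeating it on fresh blocks succeeds almost surely (`exists_loccReaches_repeat`).
Fidelity near one then gives trace-norm convergence. -/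

theorem IsSeparable.of_kronecker {a b : Type*} {τ : Matrix a a ℂ} {ω : Matrix b b ℂ}
    (hτ : τ.PosSemidef) (hω : ω.PosSemidef) : IsSeparable (τ ⊗ₖ ω) :=
  ⟨1, fun _ => τ, fun _ => ω, fun _ => hτ, fun _ => hω, by simp⟩

theorem IsSeparable.zero {a b : Type*} : IsSeparable (0 : Matrix (a × b) (a × b) ℂ) :=
  ⟨0, fun _ => 0, fun _ => 0, fun i => i.elim0, fun i => i.elim0, by simp⟩

theorem IsSeparable.add {a b : Type*} {σ σ' : Matrix (a × b) (a × b) ℂ}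
    (h : IsSeparable σ) (h' : IsSeparable σ') : IsSeparable (σ + σ') := by
  obtain ⟨n, τ, ω, hτ, hω, rfl⟩ := h
  obtain ⟨m, τ', ω', hτ', hω', rfl⟩ := h'
  refine ⟨n + m, Fin.append τ τ', Fin.append ω ω', ?_, ?_, ?_⟩
  · intro i; refine Fin.addCases (fun i => ?_) (fun i => ?_) i <;> simp [hτ, hτ']
  · intro i; refine Fin.addCases (fun i => ?_) (fun i => ?_) i <;> simp [hω, hω']
  · simp [Fin.sum_univ_add]

theorem IsSeparable.smul {a b : Type*} {σ : Matrix (a × b) (a × b) ℂ}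
    (h : IsSeparable σ) {c : ℂ} (hc : 0 ≤ c) : IsSeparable (c • σ) := by
  obtain ⟨n, τ, ω, hτ, hω, rfl⟩ := h
  exact ⟨n, fun i => c • τ i, ω, fun i => (hτ i).smul hc, hω, by
    simp [Finset.smul_sum, Matrix.smul_kronecker]⟩

theorem IsSeparable.sum {a b ι : Type*} {s : Finset ι} {σ : ι → Matrix (a × b) (a × b) ℂ}
    (h : ∀ i, IsSeparable (σ i)) : IsSeparable (∑ i ∈ s, σ i) := by
  classical
  induction s using Finset.induction_on with
  | empty => simpa using IsSeparable.zero
  | insert i s hi ih => rw [Finset.sum_insert hi]; exact (h i).add ih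

theorem IsSeparable.posSemidef {a b : Type*} [Fintype a] [Fintype b]
    {σ : Matrix (a × b) (a × b) ℂ} (h : IsSeparable σ) : σ.PosSemidef := by
  obtain ⟨n, τ, ω, hτ, hω, rfl⟩ := h
  exact posSemidef_sum _ fun i _ => (hτ i).kronecker (hω i)

theorem partialTranspose_add {a b : Type*} (X Y : Matrix (a × b) (a × b) ℂ) :
    partialTranspose (X + Y) = partialTranspose X + partialTranspose Y := rfl

theorem partialTranspose_smul {a b : Type*} (c : ℂ) (X : Matrix (a × b) (a × b) ℂ) :
    partialTranspose (c • X) = c • partialTranspose X := rfl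

theorem partialTranspose_sum {a b ι : Type*} (s : Finset ι) (X : ι → Matrix (a × b) (a × b) ℂ) :
    partialTranspose (∑ i ∈ s, X i) = ∑ i ∈ s, partialTranspose (X i) := by
  ext p q; simp [partialTranspose, Matrix.sum_apply]

theorem partialTranspose_one {a b : Type*} [DecidableEq a] [DecidableEq b] :
    partialTranspose (1 : Matrix (a × b) (a × b) ℂ) = 1 := by
  ext ⟨i, k⟩ ⟨j, l⟩
  simp only [partialTranspose, Matrix.of_apply, Matrix.one_apply, Prod.mk.injEq]
  congr 1
  simp [eq_comm]

theorem partialTranspose_kronecker {a b : Type*} (X : Matrix a a ℂ) (Y : Matrix b b ℂ) :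
    partialTranspose (X ⊗ₖ Y) = Xᵀ ⊗ₖ Y := rfl

theorem partialTranspose_partialTranspose {a b : Type*} (X : Matrix (a × b) (a × b) ℂ) :
    partialTranspose (partialTranspose X) = X := rfl

theorem partialTranspose_isHermitian {a b : Type*} {X : Matrix (a × b) (a × b) ℂ}
    (h : X.IsHermitian) : (partialTranspose X).IsHermitian := by
  ext p q
  exact h.apply _ _

theorem IsSeparable.partialTranspose {a b : Type*} {σ : Matrix (a × b) (a × b) ℂ}
    (h : IsSeparable σ) : IsSeparable (partialTranspose σ) := by
  obtain ⟨n, τ, ω, hτ, hω, rfl⟩ := h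
  exact ⟨n, fun i => (τ i)ᵀ, ω, fun i => (hτ i).transpose, hω, by
    simp [partialTranspose_sum, partialTranspose_kronecker]⟩

theorem trace_partialTranspose_mul {a b : Type*} [Fintype a] [Fintype b]
    (P X : Matrix (a × b) (a × b) ℂ) :
    (partialTranspose P * X).trace = (P * partialTranspose X).trace := by
  simp only [Matrix.trace, Matrix.diag, Matrix.mul_apply, Fintype.sum_prod_type, partialTranspose,
    Matrix.of_apply]
  rw [Finset.sum_comm]
  conv_rhs => rw [Finset.sum_comm]
  refine Finset.sum_congr rfl fun k _ => ?_
  rw [Finset.sum_comm]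

theorem exists_eq_conjTranspose_mul_self {d : Type*} [Fintype d]
    {A : Matrix d d ℂ} (hA : A.PosSemidef) : ∃ S : Matrix d d ℂ, A = Sᴴ * S := by
  classical
  open scoped MatrixOrder in
  exact CStarAlgebra.nonneg_iff_eq_star_mul_self.mp (nonneg_iff_posSemidef.mpr hA)

theorem trace_mul_nonneg {d : Type*} [Fintype d]
    {P Q : Matrix d d ℂ} (hP : P.PosSemidef) (hQ : Q.PosSemidef) : 0 ≤ (P * Q).trace := by
  obtain ⟨S, rfl⟩ := exists_eq_conjTranspose_mul_self hP
  rw [Matrix.mul_assoc, Matrix.trace_mul_comm, Matrix.mul_assoc, ← Matrix.mul_assoc]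
  exact (hQ.mul_mul_conjTranspose_same S).trace_nonneg

/-- Partial transposition can be moved to the other factor of the trace, and separable operators
have positive partial transpose. This is the only separability criterion needed below. -/
theorem IsSeparable.trace_partialTranspose_mul_nonneg {a b : Type*} [Fintype a] [Fintype b]
    {P σ : Matrix (a × b) (a × b) ℂ} (hP : P.PosSemidef) (hσ : IsSeparable σ) :
    0 ≤ (QEnt.partialTranspose P * σ).trace := by
  rw [trace_partialTranspose_mul]
  exact trace_mul_nonneg hP hσ.partialTranspose.posSemidef

/-- Averaging the products of `x + e θ y` and `v + θ⁻¹ w` over the fourth roots of unity `θ`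
leaves only the phase-invariant terms. -/
theorem isSeparable_phase_average {a b : Type*} [Finite a] [Finite b] (x y : a → ℂ) (v w : b → ℂ)
    {e : ℝ} (he : e * e = 1) :
    IsSeparable ((e : ℂ) • (vecMulVec x (star y) ⊗ₖ vecMulVec v (star w) +
        vecMulVec y (star x) ⊗ₖ vecMulVec w (star v)) +
      (vecMulVec x (star x) + vecMulVec y (star y)) ⊗ₖ
        (vecMulVec v (star v) + vecMulVec w (star w))) := by
  have key : (e : ℂ) • (vecMulVec x (star y) ⊗ₖ vecMulVec v (star w) +
        vecMulVec y (star x) ⊗ₖ vecMulVec w (star v)) +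
      (vecMulVec x (star x) + vecMulVec y (star y)) ⊗ₖ
        (vecMulVec v (star v) + vecMulVec w (star w)) =
      ∑ k : Fin 4, (1 / 4 : ℂ) •
        (vecMulVec (x + ((e : ℂ) * Complex.I ^ (k : ℕ)) • y)
            (star (x + ((e : ℂ) * Complex.I ^ (k : ℕ)) • y)) ⊗ₖ
          vecMulVec (v + ((-Complex.I) ^ (k : ℕ)) • w)
            (star (v + ((-Complex.I) ^ (k : ℕ)) • w))) := by
    have he' : (e : ℂ) * e = 1 := by exact_mod_cast he
    have hI : Complex.I * Complex.I = -1 := Complex.I_mul_I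
    have h2 : Complex.I ^ 2 = -1 := Complex.I_sq
    have h3 : Complex.I ^ 3 = -Complex.I := by rw [pow_succ, h2]; ring
    have he2 : (e : ℂ) ^ 2 = 1 := by rw [sq, he']
    ext ⟨i, k⟩ ⟨j, l⟩
    simp only [Fin.sum_univ_four, Matrix.add_apply, Matrix.smul_apply, kronecker_apply,
      vecMulVec_apply, Pi.add_apply, Pi.smul_apply, Pi.star_apply, smul_eq_mul, star_add, star_mul',
      star_pow, RCLike.star_def, Complex.conj_I, Complex.conj_ofReal, map_neg]
    have z0 : ((0 : Fin 4) : ℕ) = 0 := rfl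
    have z1 : ((1 : Fin 4) : ℕ) = 1 := rfl
    have z2 : ((2 : Fin 4) : ℕ) = 2 := rfl
    have z3 : ((3 : Fin 4) : ℕ) = 3 := rfl
    have n2 : (-Complex.I) ^ 2 = -1 := by rw [neg_sq, h2]
    have n3 : (-Complex.I) ^ 3 = Complex.I := by rw [Odd.neg_pow (by decide), h3, neg_neg]
    simp only [z0, z1, z2, z3, h2, h3, n2, n3, pow_zero, pow_one, neg_neg]
    ring_nf
    simp only [h2, he2]
    have h4 : Complex.I ^ 4 = 1 := Complex.I_pow_four
    simp only [h4]
    ring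
  rw [key]
  refine IsSeparable.sum fun k => (IsSeparable.of_kronecker ?_ ?_).smul (by positivity) <;>
    exact posSemidef_vecMulVec_self_star _

theorem isSeparable_one {a b : Type*} [Finite a] [Finite b] [DecidableEq a] [DecidableEq b] :
    IsSeparable (1 : Matrix (a × b) (a × b) ℂ) := by
  rw [← one_kronecker_one]
  exact IsSeparable.of_kronecker PosSemidef.one PosSemidef.one

/-- A vector of norm zero or one defines a projection. -/
theorem posSemidef_one_sub_vecMulVec {b : Type*} [Fintype b] [DecidableEq b] {u : b → ℂ}
    (hu : u = 0 ∨ star u ⬝ᵥ u = 1) : (1 - vecMulVec u (star u)).PosSemidef := by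
  have hH : (1 - vecMulVec u (star u))ᴴ = 1 - vecMulVec u (star u) := by
    rw [conjTranspose_sub, conjTranspose_one, conjTranspose_vecMulVec, star_star]
  have h : 1 - vecMulVec u (star u) =
      (1 - vecMulVec u (star u))ᴴ * (1 - vecMulVec u (star u)) := by
    rw [hH]
    rcases hu with rfl | hu
    · simp
    · have h2 : vecMulVec u (star u) * vecMulVec u (star u) = vecMulVec u (star u) := by
        rw [vecMulVec_mul_vecMulVec, hu, one_smul]
      rw [sub_mul, mul_sub, mul_sub, h2]
      simp
  rw [h]
  exact posSemidef_conjTranspose_mul_self _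

/-- The polar decomposition of the rows of a bipartite vector. -/
theorem exists_row_normalization {a b : Type*} [Fintype a] [Fintype b] {η : a × b → ℂ}
    (hη : star η ⬝ᵥ η = 1) : ∃ (n : a → ℝ) (u : a → b → ℂ),
      (∀ i, u i = 0 ∨ star (u i) ⬝ᵥ u i = 1) ∧ (∑ i, n i ^ 2 = 1) ∧
      ∀ i k, η (i, k) = n i * u i k := by
  have hs : ∀ i, 0 ≤ ∑ k, Complex.normSq (η (i, k)) := fun i =>
    Finset.sum_nonneg fun k _ => Complex.normSq_nonneg _
  refine ⟨fun i => Real.sqrt (∑ k, Complex.normSq (η (i, k))),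
    fun i k => η (i, k) / (Real.sqrt (∑ k, Complex.normSq (η (i, k))) : ℝ), ?_, ?_, ?_⟩
  · intro i
    by_cases h : ∑ k, Complex.normSq (η (i, k)) = 0
    · left; ext k; simp [h]
    · right
      simp only [dotProduct, Pi.star_apply, RCLike.star_def, map_div₀, Complex.conj_ofReal]
      have h1 : ∀ k, (starRingEnd ℂ) (η (i, k)) / (Real.sqrt (∑ k, Complex.normSq (η (i, k))) : ℝ) *
          (η (i, k) / (Real.sqrt (∑ k, Complex.normSq (η (i, k))) : ℝ)) =
          ((Complex.normSq (η (i, k)) / (∑ k, Complex.normSq (η (i, k))) : ℝ) : ℂ) := by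
        intro k
        rw [div_mul_div_comm, ← Complex.ofReal_mul, Real.mul_self_sqrt (hs i),
          Complex.ofReal_div, Complex.normSq_eq_conj_mul_self]
      rw [Finset.sum_congr rfl fun k _ => h1 k, ← Complex.ofReal_sum, ← Finset.sum_div, div_self h,
        Complex.ofReal_one]
  · simp only [Real.sq_sqrt (hs _)]
    have : (star η ⬝ᵥ η) = ((∑ i, ∑ k, Complex.normSq (η (i, k)) : ℝ) : ℂ) := by
      simp [dotProduct, Fintype.sum_prod_type, Complex.normSq_eq_conj_mul_self]
    rw [this] at hη
    exact_mod_cast hη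
  · intro i k
    by_cases h : ∑ k, Complex.normSq (η (i, k)) = 0
    · have h2 := (Finset.sum_eq_zero_iff_of_nonneg fun k _ => Complex.normSq_nonneg _).mp h k
        (Finset.mem_univ k)
      simp [Complex.normSq_eq_zero.mp h2]
    · have h3 : Real.sqrt (∑ k, Complex.normSq (η (i, k))) ≠ 0 := by
        rw [Real.sqrt_ne_zero (hs i)]; exact h
      field_simp

/-- Write `η = ∑ nᵢ |i⟩ ⊗ uᵢ`. Phase averaging with `x = nⱼ|i⟩`, `y = nᵢ|j⟩`, `v = uᵢ`, `w = uⱼ`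
produces the cross terms of `e|η⟩⟨η|`. The crossed weights make the diagonal remainder `∑ nⱼ²|i⟩⟨i|
⊗ (uᵢuᵢ* + uⱼuⱼ*)`, which the projections `1 - uᵢuᵢ*` and `1 - uⱼuⱼ*` complete to `2𝟙`, since `∑ nⱼ²
= 1`. -/
theorem isSeparable_two_add_smul_rank_one {a b : Type*} [Fintype a] [Fintype b] [DecidableEq a]
    [DecidableEq b] {η : a × b → ℂ} (hη : star η ⬝ᵥ η = 1) {e : ℝ} (he : e * e = 1) :
    IsSeparable ((2 : ℂ) • (1 : Matrix (a × b) (a × b) ℂ) + (e : ℂ) • vecMulVec η (star η)) := by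
  obtain ⟨n, u, hu, hn, hηu⟩ := exists_row_normalization hη
  have hn' : ∑ i, (n i : ℂ) ^ 2 = 1 := by exact_mod_cast hn
  have hsep : IsSeparable (∑ i, ∑ j, ((1 / 2 : ℂ) •
      ((e : ℂ) • (vecMulVec ((n j : ℂ) • Pi.single i 1) (star ((n i : ℂ) • Pi.single j 1)) ⊗ₖ
            vecMulVec (u i) (star (u j)) +
          vecMulVec ((n i : ℂ) • Pi.single j 1) (star ((n j : ℂ) • Pi.single i 1)) ⊗ₖ
            vecMulVec (u j) (star (u i))) +
        (vecMulVec ((n j : ℂ) • Pi.single i 1) (star ((n j : ℂ) • Pi.single i 1)) +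
          vecMulVec ((n i : ℂ) • Pi.single j 1) (star ((n i : ℂ) • Pi.single j 1))) ⊗ₖ
        (vecMulVec (u i) (star (u i)) + vecMulVec (u j) (star (u j)))) +
      (Matrix.diagonal (Pi.single i 1) : Matrix a a ℂ) ⊗ₖ (((n j ^ 2 : ℝ) : ℂ) •
        ((1 - vecMulVec (u i) (star (u i))) + (1 - vecMulVec (u j) (star (u j))))))) := by
    refine IsSeparable.sum fun i => IsSeparable.sum fun j => IsSeparable.add ?_ ?_
    · exact (isSeparable_phase_average _ _ _ _ he).smul (by positivity)
    · refine IsSeparable.of_kronecker (PosSemidef.diagonal ?_) (PosSemidef.smul ?_ ?_)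
      · intro k; by_cases h : k = i
        · subst h; simp
        · simp [h]
      · exact (posSemidef_one_sub_vecMulVec (hu i)).add (posSemidef_one_sub_vecMulVec (hu j))
      · exact_mod_cast sq_nonneg (n j)
  convert hsep using 1
  ext ⟨r, s⟩ ⟨r', s'⟩
  -- The phase-averaged terms are symmetric in `i` and `j`; the factor `1/2` undoes this double
  -- counting.
  have hg : ∀ g : a → a → ℂ, ∑ i, ∑ j, (1 / 2 : ℂ) * (g i j + g j i) = ∑ i, ∑ j, g i j := by
    intro g
    simp only [mul_add, Finset.sum_add_distrib]
    rw [Finset.sum_comm (f := fun i j => (1 / 2 : ℂ) * g j i), ← Finset.sum_add_distrib]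
    refine Finset.sum_congr rfl fun i _ => ?_
    rw [← Finset.sum_add_distrib]
    exact Finset.sum_congr rfl fun j _ => by ring
  set D : a → a → ℂ := fun i r => if r = i then 1 else 0 with hD
  set G : a → a → ℂ := fun i j =>
    e * (n j * n i * D i r * D j r' * (u i s * star (u j s'))) +
      (n j) ^ 2 * (D i r * D i r') * (u i s * star (u i s') + u j s * star (u j s')) with hG
  set R : a → a → ℂ := fun i j => (if r = r' then D i r else 0) * (((n j : ℂ) ^ 2) *
      (((if s = s' then 1 else 0) - u i s * star (u i s')) +
        ((if s = s' then 1 else 0) - u j s * star (u j s')))) with hR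
  have hDD : ∀ i, (if r = r' then D i r else 0) = D i r * D i r' := by
    intro i
    by_cases h : r = r'
    · subst h; simp [hD]
    · by_cases h1 : r = i
      · subst h1; simp [hD, h, Ne.symm h]
      · simp [hD, h1]
  have hsum : ∑ i, ∑ j, ((1 / 2 : ℂ) * (G i j + G j i) + R i j) =
      ∑ i, ∑ j, (e * (n j * n i * D i r * D j r' * (u i s * star (u j s'))) +
        2 * ((n j : ℂ) ^ 2 * ((if r = r' then D i r else 0) * (if s = s' then 1 else 0)))) := by
    simp only [Finset.sum_add_distrib (f := fun j => (1 / 2 : ℂ) * (G _ j + G j _))]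
    rw [Finset.sum_add_distrib, hg G]
    simp only [← Finset.sum_add_distrib]
    refine Finset.sum_congr rfl fun i _ => Finset.sum_congr rfl fun j _ => ?_
    simp only [hG, hR, hDD]
    ring
  calc _ = ∑ i, ∑ j, (e * (n j * n i * D i r * D j r' * (u i s * star (u j s'))) +
        2 * ((n j : ℂ) ^ 2 * ((if r = r' then D i r else 0) * (if s = s' then 1 else 0)))) := by
        simp only [Finset.sum_add_distrib, ← Finset.mul_sum, ← Finset.sum_mul, hn', hD]
        simp [Matrix.one_apply, vecMulVec_apply, hηu, ite_and]
        split_ifs <;> ring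
    _ = _ := by
        rw [← hsum]
        simp only [Matrix.sum_apply]
        refine Finset.sum_congr rfl fun i _ => Finset.sum_congr rfl fun j _ => ?_
        simp only [hG, hR, hD, Matrix.add_apply, Matrix.smul_apply, kronecker_apply,
          vecMulVec_apply, Pi.smul_apply, Pi.star_apply, smul_eq_mul, star_mul', Matrix.sub_apply,
          Matrix.diagonal_apply, Pi.single_apply, RCLike.star_def, Complex.conj_ofReal,
          apply_ite (starRingEnd ℂ), map_one, map_zero, Matrix.one_apply, Complex.ofReal_pow]
        ring

/-! ### Completely positive maps in Kraus form -/

/-- The completely positive map with Kraus operators `V i`. -/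
def krausMap {d d' ι : Type*} [Fintype d] [Fintype ι] (V : ι → Matrix d' d ℂ) :
    Matrix d d ℂ →ₗ[ℂ] Matrix d' d' ℂ where
  toFun X := ∑ i, V i * X * (V i)ᴴ
  map_add' X Y := by simp [Matrix.mul_add, Matrix.add_mul, Finset.sum_add_distrib]
  map_smul' c X := by simp [Finset.smul_sum]

theorem krausMap_apply {d d' ι : Type*} [Fintype d] [Fintype ι] (V : ι → Matrix d' d ℂ)
    (X : Matrix d d ℂ) : krausMap V X = ∑ i, V i * X * (V i)ᴴ := rfl

/-- Product operators span, so identities between maps on composite systems need only be checked on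
them. -/
theorem linearMap_ext_kronecker {a b : Type*} [Fintype a] [DecidableEq a] [Fintype b]
    [DecidableEq b] {M : Type*} [AddCommMonoid M] [Module ℂ M]
    {f g : Matrix (a × b) (a × b) ℂ →ₗ[ℂ] M}
    (h : ∀ X Y, f (X ⊗ₖ Y) = g (X ⊗ₖ Y)) : f = g := by
  have : f ∘ₗ (kroneckerLinearEquiv a a b b ℂ).toLinearMap =
      g ∘ₗ (kroneckerLinearEquiv a a b b ℂ).toLinearMap := by
    apply TensorProduct.ext'
    intro X Y
    simpa using h X Y
  ext1 X
  obtain ⟨Z, rfl⟩ := (kroneckerLinearEquiv a a b b ℂ).surjective X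
  exact LinearMap.congr_fun this Z

theorem tensorMap_krausMap {a b a' b' ι κ : Type*} [Fintype a] [DecidableEq a] [Fintype b]
    [DecidableEq b] [Fintype a'] [DecidableEq a'] [Fintype b'] [DecidableEq b']
    [Fintype ι] [Fintype κ] (V : ι → Matrix a' a ℂ) (U : κ → Matrix b' b ℂ) :
    tensorMap (krausMap V) (krausMap U) = krausMap fun p : ι × κ => V p.1 ⊗ₖ U p.2 := by
  apply linearMap_ext_kronecker
  intro X Y
  simp only [tensorMap_kronecker, krausMap_apply, conjTranspose_kronecker, ← mul_kronecker_mul]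
  ext ⟨i, k⟩ ⟨j, l⟩
  simp only [kronecker_apply, Matrix.sum_apply, Fintype.sum_prod_type, Finset.sum_mul_sum]

theorem krausMap_one {d : Type*} [Fintype d] [DecidableEq d] :
    krausMap (fun _ : Unit => (1 : Matrix d d ℂ)) = LinearMap.id := by
  ext1 X; simp [krausMap_apply]

theorem krausMap_posSemidef {d d' ι : Type*} [Fintype d] [Fintype d'] [Fintype ι]
    (V : ι → Matrix d' d ℂ) {X : Matrix d d ℂ} (hX : X.PosSemidef) : (krausMap V X).PosSemidef :=
  posSemidef_sum _ fun i _ => hX.mul_mul_conjTranspose_same (V i)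

theorem krausMap_isCompletelyPositive {d d' ι : Type*} [Fintype d] [DecidableEq d] [Fintype d']
    [DecidableEq d'] [Fintype ι] (V : ι → Matrix d' d ℂ) : IsCompletelyPositive (krausMap V) := by
  intro k M hM
  rw [← krausMap_one, tensorMap_krausMap]
  exact krausMap_posSemidef _ hM

theorem trace_krausMap {d d' ι : Type*} [Fintype d] [Fintype d'] [Fintype ι]
    (V : ι → Matrix d' d ℂ) (X : Matrix d d ℂ) :
    (krausMap V X).trace = ((∑ i, (V i)ᴴ * V i) * X).trace := by
  rw [krausMap_apply, trace_sum, Finset.sum_mul, trace_sum]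
  exact Finset.sum_congr rfl fun i _ => by rw [trace_mul_comm, Matrix.mul_assoc]

theorem krausMap_isTracePreserving {d d' ι : Type*} [Fintype d] [DecidableEq d] [Fintype d']
    [Fintype ι] {V : ι → Matrix d' d ℂ} (hV : ∑ i, (V i)ᴴ * V i = 1) :
    IsTracePreserving (krausMap V) := fun X => by rw [trace_krausMap, hV, Matrix.one_mul]

theorem krausMap_isChannel {d d' ι : Type*} [Fintype d] [DecidableEq d] [Fintype d']
    [DecidableEq d'] [Fintype ι] {V : ι → Matrix d' d ℂ} (hV : ∑ i, (V i)ᴴ * V i = 1) :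
    IsChannel (krausMap V) :=
  ⟨krausMap_isCompletelyPositive V, krausMap_isTracePreserving hV⟩

theorem IsCompletelyPositive.add {d d' : Type*} [Fintype d] [DecidableEq d] [Fintype d']
    [DecidableEq d'] {Φ Ψ : Matrix d d ℂ →ₗ[ℂ] Matrix d' d' ℂ}
    (hΦ : IsCompletelyPositive Φ) (hΨ : IsCompletelyPositive Ψ) :
    IsCompletelyPositive (Φ + Ψ) := by
  intro k M hM
  have : tensorMap (LinearMap.id : Matrix (Fin k) (Fin k) ℂ →ₗ[ℂ] Matrix (Fin k) (Fin k) ℂ)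
      (Φ + Ψ) = tensorMap LinearMap.id Φ + tensorMap LinearMap.id Ψ := by
    apply linearMap_ext_kronecker
    intro X Y
    simp [tensorMap_kronecker, kronecker_add]
  rw [this]
  exact (hΦ k M hM).add (hΨ k M hM)

/-- The map `X ↦ Tr(A X) B`. -/
def prepareMap {d d' : Type*} [Fintype d] (A : Matrix d d ℂ) (B : Matrix d' d' ℂ) :
    Matrix d d ℂ →ₗ[ℂ] Matrix d' d' ℂ where
  toFun X := (A * X).trace • B
  map_add' X Y := by simp only [mul_add, trace_add, add_smul]
  map_smul' c X := by simp only [Matrix.mul_smul, trace_smul, smul_assoc, RingHom.id_apply]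

/-- With `A = S*S` and `B = T*T`, the operators `T*|i⟩⟨j|S` form a Kraus family for the map. -/
theorem prepareMap_isCompletelyPositive {d d' : Type*} [Fintype d] [DecidableEq d] [Fintype d']
    [DecidableEq d'] {A : Matrix d d ℂ} {B : Matrix d' d' ℂ} (hA : A.PosSemidef)
    (hB : B.PosSemidef) : IsCompletelyPositive (prepareMap A B) := by
  obtain ⟨S, rfl⟩ := exists_eq_conjTranspose_mul_self hA
  obtain ⟨T, rfl⟩ := exists_eq_conjTranspose_mul_self hB
  have : prepareMap (Sᴴ * S) (Tᴴ * T) =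
      krausMap fun p : d' × d => Tᴴ * Matrix.single p.1 p.2 (1 : ℂ) * S := by
    ext1 X
    have h1 : ∀ (i : d') (j : d), Tᴴ * Matrix.single i j (1 : ℂ) * S * X *
        (Tᴴ * Matrix.single i j (1 : ℂ) * S)ᴴ =
        Tᴴ * (Matrix.single i j (1 : ℂ) * (S * X * Sᴴ) * Matrix.single j i (1 : ℂ)) * T := by
      intro i j
      simp only [conjTranspose_mul, conjTranspose_single, star_one, conjTranspose_conjTranspose,
        Matrix.mul_assoc]
    simp only [krausMap_apply, h1, Fintype.sum_prod_type, single_mul_mul_single, one_mul, mul_one]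
    simp only [← Finset.sum_mul, ← Finset.mul_sum]
    have h2 : ∑ i : d', ∑ j : d, Matrix.single i i ((S * X * Sᴴ) j j) =
        (S * X * Sᴴ).trace • (1 : Matrix d' d' ℂ) := by
      ext i j
      simp [Matrix.sum_apply, Matrix.single_apply, Matrix.one_apply, Matrix.trace, ite_and]
    rw [h2]
    simp only [prepareMap, LinearMap.coe_mk, AddHom.coe_mk, Matrix.mul_smul, Matrix.mul_one,
      Matrix.smul_mul]
    rw [Matrix.mul_assoc, trace_mul_comm]
  rw [this]
  exact krausMap_isCompletelyPositive _

/-! ### The maximally entangled two-qubit state -/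

theorem phiPlus_two_apply (p q : Fin 2 × Fin 2) :
    phiPlus 2 p q = if p.1 = p.2 ∧ q.1 = q.2 then 1 / 2 else 0 := by
  have h : ((1 / Real.sqrt 2 : ℝ) : ℂ) * ((1 / Real.sqrt 2 : ℝ) : ℂ) = 1 / 2 := by
    rw [← Complex.ofReal_mul, div_mul_div_comm, Real.mul_self_sqrt (by norm_num)]
    norm_num
  simp only [phiPlus, vecMulVec_apply, phiPlusVec, Pi.star_apply, Nat.cast_ofNat]
  by_cases h1 : p.1 = p.2 <;> by_cases h2 : q.1 = q.2 <;>
    simp only [h1, h2, if_true, if_false, and_true, and_false, star_zero, mul_zero, zero_mul,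
      RCLike.star_def, Complex.conj_ofReal, h]

theorem phiPlus_posSemidef (d : ℕ) : (phiPlus d).PosSemidef := posSemidef_vecMulVec_self_star _

theorem trace_phiPlus_two : (phiPlus 2).trace = 1 := by
  simp [Matrix.trace, Fintype.sum_prod_type, phiPlus_two_apply]

theorem phiPlus_two_mul_self : phiPlus 2 * phiPlus 2 = phiPlus 2 := by
  ext ⟨i, k⟩ ⟨j, l⟩
  simp only [Matrix.mul_apply, phiPlus_two_apply, Fintype.sum_prod_type, Fin.sum_univ_two]
  by_cases h1 : i = k <;> by_cases h2 : j = l <;> simp [h1, h2]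
  norm_num

/-- This is the isotropic operator at the separability threshold: phase averaging gives the
coherences between `|00⟩` and `|11⟩` together with `𝟙`, and two diagonal product terms supply the
rest. -/
theorem isSeparable_one_add_two_phiPlus :
    IsSeparable ((1 : Matrix (Fin 2 × Fin 2) (Fin 2 × Fin 2) ℂ) + (2 : ℂ) • phiPlus 2) := by
  have h := (isSeparable_phase_average (Pi.single 0 1 : Fin 2 → ℂ) (Pi.single 1 1)
    (Pi.single 0 1 : Fin 2 → ℂ) (Pi.single 1 1) (e := 1) (by norm_num)).add
    ((IsSeparable.of_kronecker (posSemidef_vecMulVec_self_star (Pi.single 0 1 : Fin 2 → ℂ))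
      (posSemidef_vecMulVec_self_star (Pi.single 0 1 : Fin 2 → ℂ))).add
    (IsSeparable.of_kronecker (posSemidef_vecMulVec_self_star (Pi.single 1 1 : Fin 2 → ℂ))
      (posSemidef_vecMulVec_self_star (Pi.single 1 1 : Fin 2 → ℂ))))
  convert h using 1
  ext ⟨i, k⟩ ⟨j, l⟩
  simp only [Matrix.add_apply, Matrix.smul_apply, phiPlus_two_apply, kronecker_apply,
    vecMulVec_apply, Matrix.one_apply, Pi.star_apply]
  fin_cases i <;> fin_cases j <;> fin_cases k <;> fin_cases l <;> simp

/-- `2φ₂⁺^Γ` is the swap `F`, an involution, so `X = 𝟙 ± F` is Hermitian with `X² = 2X`. -/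
theorem posSemidef_one_add_smul_swap {e : ℂ} (he : e = 1 ∨ e = -1) :
    ((1 : Matrix (Fin 2 × Fin 2) (Fin 2 × Fin 2) ℂ) +
      (e * 2) • partialTranspose (phiPlus 2)).PosSemidef := by
  set X := (1 : Matrix (Fin 2 × Fin 2) (Fin 2 × Fin 2) ℂ) + (e * 2) • partialTranspose (phiPlus 2)
    with hX
  have h : X = (1 / 2 : ℂ) • (X * Xᴴ) := by
    ext ⟨i, k⟩ ⟨j, l⟩
    simp only [hX, Matrix.mul_apply, Fintype.sum_prod_type, Fin.sum_univ_two, Matrix.smul_apply,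
      Matrix.add_apply, partialTranspose, Matrix.of_apply, phiPlus_two_apply, Matrix.one_apply,
      conjTranspose_apply]
    rcases he with rfl | rfl <;>
    fin_cases i <;> fin_cases j <;> fin_cases k <;> fin_cases l <;> simp <;> norm_num
  rw [h]
  exact (posSemidef_self_mul_conjTranspose X).smul (by positivity)

/-- `𝟙 - 2φ₂⁺` is the partial transpose of the positive operator `𝟙 - F`, `F` the swap. A separable
state thus has fidelity at most `1/2` with `φ₂⁺`. -/
theorem IsSeparable.two_mul_trace_phiPlus_mul_le {σ : Matrix (Fin 2 × Fin 2) (Fin 2 × Fin 2) ℂ}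
    (hσ : IsSeparable σ) : 0 ≤ σ.trace - 2 * (phiPlus 2 * σ).trace := by
  have h := hσ.trace_partialTranspose_mul_nonneg (posSemidef_one_add_smul_swap (Or.inr rfl))
  rw [partialTranspose_add, partialTranspose_smul, partialTranspose_partialTranspose,
    partialTranspose_one, add_mul, trace_add, smul_mul_assoc, trace_smul, one_mul, smul_eq_mul] at h
  convert h using 1
  ring

/-! ### The witness and the test operator -/

theorem posSemidef_one_sub_rank_one {d : Type*} [Fintype d] [DecidableEq d] {η : d → ℂ}
    (hη : star η ⬝ᵥ η = 1) : (1 - vecMulVec η (star η)).PosSemidef :=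
  posSemidef_one_sub_vecMulVec (Or.inr hη)

theorem isSeparable_two_add_witness {a b : Type*} [Fintype a] [Fintype b] [DecidableEq a]
    [DecidableEq b] {η : a × b → ℂ} (hη : star η ⬝ᵥ η = 1) :
    IsSeparable ((2 : ℂ) • (1 : Matrix (a × b) (a × b) ℂ) + witness η) := by
  have h := (isSeparable_two_add_smul_rank_one hη (e := 1) (by norm_num)).partialTranspose
  rwa [partialTranspose_add, partialTranspose_smul, partialTranspose_one, Complex.ofReal_one,
    one_smul] at h

theorem isSeparable_two_sub_witness {a b : Type*} [Fintype a] [Fintype b] [DecidableEq a]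
    [DecidableEq b] {η : a × b → ℂ} (hη : star η ⬝ᵥ η = 1) :
    IsSeparable ((2 : ℂ) • (1 : Matrix (a × b) (a × b) ℂ) - witness η) := by
  have h := (isSeparable_two_add_smul_rank_one hη (e := -1) (by norm_num)).partialTranspose
  rwa [partialTranspose_add, partialTranspose_smul, partialTranspose_one, partialTranspose_smul,
    Complex.ofReal_neg, Complex.ofReal_one, neg_smul, one_smul, ← sub_eq_add_neg] at h

/-- Let `ηⱼ = nⱼuⱼ` be the rows of `η` and `zᵢⱼ = |i⟩⊗ηⱼ - |j⟩⊗ηᵢ`. Then `½∑ zᵢⱼzᵢⱼ* = 𝟙 ⊗ ∑ ηⱼηⱼ* -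
W`, and `𝟙 ⊗ (𝟙 - ∑ ηⱼηⱼ*)` is positive because `∑ nⱼ² = 1`. Adding the two gives `𝟙 - W`. -/
theorem posSemidef_one_sub_witness {a b : Type*} [Fintype a] [Fintype b] [DecidableEq a]
    [DecidableEq b] {η : a × b → ℂ} (hη : star η ⬝ᵥ η = 1) :
    ((1 : Matrix (a × b) (a × b) ℂ) - witness η).PosSemidef := by
  obtain ⟨n, u, hu, hn, hηu⟩ := exists_row_normalization hη
  have hn' : ∑ i, (n i : ℂ) ^ 2 = 1 := by exact_mod_cast hn
  set z : a → a → a × b → ℂ := fun i j p =>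
    (if p.1 = i then η (j, p.2) else 0) - (if p.1 = j then η (i, p.2) else 0) with hz
  have hpsd : ((1 : Matrix a a ℂ) ⊗ₖ (∑ j, ((n j ^ 2 : ℝ) : ℂ) • (1 - vecMulVec (u j) (star (u j))))
      + (1 / 2 : ℂ) • ∑ i, ∑ j, vecMulVec (z i j) (star (z i j))).PosSemidef := by
    refine (PosSemidef.one.kronecker (posSemidef_sum _ fun j _ =>
      (posSemidef_one_sub_vecMulVec (hu j)).smul ?_)).add
      ((posSemidef_sum _ fun i _ => posSemidef_sum _ fun j _ =>
        posSemidef_vecMulVec_self_star _).smul (by positivity))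
    exact_mod_cast sq_nonneg (n j)
  convert hpsd using 1
  ext ⟨r, s⟩ ⟨r', s'⟩
  have hU : (∑ j, ((n j ^ 2 : ℝ) : ℂ) • (1 - vecMulVec (u j) (star (u j)))) s s' =
      (if s = s' then 1 else 0) - ∑ j, η (j, s) * star (η (j, s')) := by
    have hss : (if s = s' then 1 else 0) = ∑ i, (n i : ℂ) ^ 2 * (if s = s' then 1 else 0) := by
      rw [← Finset.sum_mul, hn', one_mul]
    rw [hss, ← Finset.sum_sub_distrib, Matrix.sum_apply]
    refine Finset.sum_congr rfl fun j _ => ?_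
    simp only [Matrix.smul_apply, Matrix.sub_apply, Matrix.one_apply, vecMulVec_apply,
      Pi.star_apply, hηu, star_mul', RCLike.star_def, Complex.conj_ofReal, smul_eq_mul,
      Complex.ofReal_pow]
    ring
  have hZ : ((1 / 2 : ℂ) • ∑ i, ∑ j, vecMulVec (z i j) (star (z i j))) (r, s) (r', s') =
      (if r = r' then ∑ j, η (j, s) * star (η (j, s')) else 0) - η (r', s) * star (η (r, s')) := by
    simp only [Matrix.smul_apply, Matrix.sum_apply, vecMulVec_apply, Pi.star_apply, smul_eq_mul,
      hz, mul_sub, sub_mul, star_sub, Finset.sum_sub_distrib, apply_ite star, star_zero, ite_mul,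
      mul_ite, zero_mul, mul_zero, Finset.sum_ite_eq, Finset.mem_univ, if_true]
    by_cases h : r = r'
    · subst h
      simp [Finset.sum_ite_irrel]
      ring
    · simp [h]
      ring
  rw [Matrix.add_apply, hZ, kronecker_apply, hU]
  by_cases h : r = r'
  · subst h
    simp [witness, partialTranspose, vecMulVec_apply, Matrix.one_apply]
  · simp [witness, partialTranspose, vecMulVec_apply, h]

theorem exists_isNegativeUnitEigenvector {d : Type*} [Fintype d] [DecidableEq d]
    {M : Matrix d d ℂ} (hM : M.IsHermitian) (h : ¬ M.PosSemidef) :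
    ∃ η, IsNegativeUnitEigenvector M η := by
  rw [hM.posSemidef_iff_eigenvalues_nonneg, Pi.le_def] at h
  push Not at h
  obtain ⟨i, hi⟩ := h
  refine ⟨⇑(hM.eigenvectorBasis i), ?_, hM.eigenvalues i, hi, ?_⟩
  · have h1 := hM.eigenvectorBasis.orthonormal.1 i
    have h2 : inner ℂ (hM.eigenvectorBasis i) (hM.eigenvectorBasis i) = (1 : ℂ) := by
      rw [inner_self_eq_norm_sq_to_K, h1]; simp
    rw [EuclideanSpace.inner_eq_star_dotProduct, dotProduct_comm] at h2
    exact h2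
  · have := hM.mulVec_eigenvectorBasis i
    rw [this]
    rfl

theorem trace_witness_mul {a b : Type*} [Fintype a] [Fintype b] (η : a × b → ℂ)
    (X : Matrix (a × b) (a × b) ℂ) :
    (witness η * X).trace = star η ⬝ᵥ (partialTranspose X *ᵥ η) := by
  rw [witness, trace_partialTranspose_mul, vecMulVec_mul, trace_vecMulVec, dotProduct_comm,
    dotProduct_mulVec]

theorem one_sub_testOperator {a b : Type*} [DecidableEq a] [DecidableEq b] (η : a × b → ℂ) :
    1 - testOperator η = (1 / 3 : ℂ) • (1 - witness η) := by
  rw [testOperator]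
  module

section testOperator

variable {a b : Type*} [Fintype a] [Fintype b] [DecidableEq a] [DecidableEq b] {η : a × b → ℂ}

theorem isSeparable_testOperator (hη : star η ⬝ᵥ η = 1) : IsSeparable (testOperator η) := by
  rw [testOperator, add_comm]
  exact (isSeparable_two_add_witness hη).smul (by positivity)

theorem posSemidef_one_sub_testOperator (hη : star η ⬝ᵥ η = 1) :
    (1 - testOperator η).PosSemidef := by
  rw [one_sub_testOperator]
  exact (posSemidef_one_sub_witness hη).smul (by positivity)

end testOperator

/-! ### The measure-and-prepare map and its dual -/

section measurePrepare

variable {d : Type*} [Fintype d] [DecidableEq d] {A : Matrix d d ℂ}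

theorem measurePrepare_apply (A X : Matrix d d ℂ) : measurePrepare A X =
    (A * X).trace • ((1 / 4 : ℂ) • (1 : Matrix (Fin 2 × Fin 2) (Fin 2 × Fin 2) ℂ)) +
    ((1 - A) * X).trace • phiPlus 2 := rfl

theorem measurePrepare_isCompletelyPositive (hA : A.PosSemidef) (hA' : (1 - A).PosSemidef) :
    IsCompletelyPositive (measurePrepare A) := by
  have h : measurePrepare A = prepareMap A ((1 / 4 : ℂ) • 1) + prepareMap (1 - A) (phiPlus 2) :=
    LinearMap.ext fun X => rfl
  rw [h]
  exact (prepareMap_isCompletelyPositive hA (PosSemidef.one.smul (by positivity))).add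
    (prepareMap_isCompletelyPositive hA' (phiPlus_posSemidef 2))

theorem measurePrepare_isTracePreserving : IsTracePreserving (measurePrepare A) := by
  intro X
  rw [measurePrepare_apply, trace_add, trace_smul, trace_smul, trace_smul, trace_one,
    trace_phiPlus_two, sub_mul, trace_sub, one_mul]
  simp

theorem dualMap_measurePrepare_apply (Y : Matrix (Fin 2 × Fin 2) (Fin 2 × Fin 2) ℂ) :
    dualMap (measurePrepare A) Y =
      (Y.trace / 4) • A + (phiPlus 2 * Y).trace • (1 - A) := by
  have h : ∀ (B : Matrix d d ℂ) (i j : d), (B * Matrix.single j i (1 : ℂ)).trace = B i j := by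
    intro B i j
    rw [trace_mul_comm, trace_single_mul]
    simp
  ext i j
  simp only [dualMap, LinearMap.coe_mk, AddHom.coe_mk, Matrix.of_apply, measurePrepare_apply, h,
    add_mul, smul_mul_assoc, one_mul, trace_add, trace_smul, Matrix.add_apply, Matrix.smul_apply,
    smul_eq_mul]
  ring

theorem dualMap_measurePrepare_isCompletelyPositive (hA : A.PosSemidef)
    (hA' : (1 - A).PosSemidef) : IsCompletelyPositive (dualMap (measurePrepare A)) := by
  have : dualMap (measurePrepare A) =
      prepareMap ((1 / 4 : ℂ) • 1) A + prepareMap (phiPlus 2) (1 - A) := by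
    ext1 Y
    rw [dualMap_measurePrepare_apply, LinearMap.add_apply]
    simp only [prepareMap, LinearMap.coe_mk, AddHom.coe_mk, smul_mul_assoc, one_mul, trace_smul,
      smul_eq_mul]
    congr 2
    ring
  rw [this]
  exact (prepareMap_isCompletelyPositive (PosSemidef.one.smul (by positivity)) hA).add
    (prepareMap_isCompletelyPositive (phiPlus_posSemidef 2) hA')

end measurePrepare

/-! ### Preservation of separability and the PPT property -/

section

variable {a b : Type*} [Fintype a] [Fintype b] [DecidableEq a] [DecidableEq b] {η : a × b → ℂ}

theorem trace_testOperator_mul (X : Matrix (a × b) (a × b) ℂ) :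
    (testOperator η * X).trace = ((witness η * X).trace + 2 * X.trace) / 3 := by
  rw [testOperator, smul_mul_assoc, add_mul, trace_smul, trace_add, smul_mul_assoc, trace_smul,
    one_mul, smul_eq_mul, smul_eq_mul]
  ring

theorem trace_one_sub_testOperator_mul (X : Matrix (a × b) (a × b) ℂ) :
    ((1 - testOperator η) * X).trace = (X.trace - (witness η * X).trace) / 3 := by
  rw [sub_mul, trace_sub, one_mul, trace_testOperator_mul]
  ring

theorem measurePrepare_testOperator_isNonEntangling (hη : star η ⬝ᵥ η = 1) :
    IsNonEntangling (measurePrepare (testOperator η)) := by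
  refine ⟨measurePrepare_isCompletelyPositive (isSeparable_testOperator hη).posSemidef
    (posSemidef_one_sub_testOperator hη), fun σ hσ => ?_⟩
  have hw : 0 ≤ (witness η * σ).trace :=
    hσ.trace_partialTranspose_mul_nonneg (posSemidef_vecMulVec_self_star η)
  have hB := trace_mul_nonneg (posSemidef_one_sub_testOperator hη) hσ.posSemidef
  -- As much noise as `φ₂⁺` needs is grouped with it into the threshold operator `𝟙 + 2φ₂⁺`; the
  -- leftover noise has weight proportional to `Tr(Wσ) ≥ 0`.
  have : measurePrepare (testOperator η) σ =
      ((witness η * σ).trace * (1 / 4)) • (1 : Matrix (Fin 2 × Fin 2) (Fin 2 × Fin 2) ℂ) +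
      (((1 - testOperator η) * σ).trace * (1 / 2)) • (1 + (2 : ℂ) • phiPlus 2) := by
    rw [measurePrepare_apply, trace_testOperator_mul, trace_one_sub_testOperator_mul]
    module
  rw [this]
  exact (isSeparable_one.smul (mul_nonneg hw (by positivity))).add
    (isSeparable_one_add_two_phiPlus.smul (mul_nonneg hB (by positivity)))

theorem dualMap_measurePrepare_testOperator_isNonEntangling (hη : star η ⬝ᵥ η = 1) :
    IsNonEntangling (dualMap (measurePrepare (testOperator η))) := by
  refine ⟨dualMap_measurePrepare_isCompletelyPositive (isSeparable_testOperator hη).posSemidef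
    (posSemidef_one_sub_testOperator hη), fun σ hσ => ?_⟩
  have hf := trace_mul_nonneg (phiPlus_posSemidef 2) hσ.posSemidef
  have ht := hσ.two_mul_trace_phiPlus_mul_le
  -- With `f = Tr(φ₂⁺σ)`, the image is `(Tr σ - 2f)/4 · A + f(𝟙 - A/2)`, and `𝟙 - A/2 = ((2𝟙 - W) +
  -- 2𝟙)/6`. The first weight is nonnegative by the fidelity bound for separable `σ`.
  have : dualMap (measurePrepare (testOperator η)) σ =
      ((σ.trace - 2 * (phiPlus 2 * σ).trace) * (1 / 4)) • testOperator η +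
      ((phiPlus 2 * σ).trace * (1 / 6)) •
        (((2 : ℂ) • (1 : Matrix (a × b) (a × b) ℂ) - witness η) + (2 : ℂ) • 1) := by
    rw [dualMap_measurePrepare_apply, testOperator]
    module
  rw [this]
  exact ((isSeparable_testOperator hη).smul (mul_nonneg ht (by positivity))).add
    (((isSeparable_two_sub_witness hη).add (isSeparable_one.smul (by positivity))).smul
      (mul_nonneg hf (by positivity)))

theorem choi_measurePrepare (A : Matrix (a × b) (a × b) ℂ) :
    choi (measurePrepare A) =
      ((1 / 4 : ℂ) • (1 : Matrix (Fin 2 × Fin 2) (Fin 2 × Fin 2) ℂ)) ⊗ₖ Aᵀ +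
        phiPlus 2 ⊗ₖ (1 - A)ᵀ := by
  have h : ∀ (B : Matrix (a × b) (a × b) ℂ) (i j), (B * Matrix.single i j (1 : ℂ)).trace = B j i := by
    intro B i j
    rw [trace_mul_comm, trace_single_mul]
    simp
  ext ⟨i, k⟩ ⟨j, l⟩
  simp only [choi, Matrix.sum_apply, kronecker_apply, measurePrepare_apply, h, Matrix.single_apply,
    Matrix.add_apply, Matrix.smul_apply, transpose_apply, mul_ite, mul_zero, mul_one, smul_eq_mul]
  rw [Finset.sum_eq_single k (fun x _ hx => by simp [hx]) (by simp),
    Finset.sum_eq_single l (fun x _ hx => by simp [hx]) (by simp), if_pos ⟨rfl, rfl⟩]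
  ring

theorem measurePrepare_testOperator_isPPTMap (hη : star η ⬝ᵥ η = 1) :
    IsPPTMap (measurePrepare (testOperator η)) := by
  refine ⟨measurePrepare_isCompletelyPositive (isSeparable_testOperator hη).posSemidef
    (posSemidef_one_sub_testOperator hη), ?_⟩
  set E := (vecMulVec η (star η))ᵀ with hE
  have hE0 : E.PosSemidef := (posSemidef_vecMulVec_self_star η).transpose
  have hE1 : (1 - E).PosSemidef := by
    have := (posSemidef_one_sub_rank_one hη).transpose
    rwa [transpose_sub, transpose_one] at this
  -- Partial transposition turns `φ₂⁺` into `F/2`, with `F` the swap, and the transposed `W` into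
  -- `E`. The Choi operator becomes `𝟙⊗(E + 2𝟙)/12 + F⊗(𝟙 - E)/6`, written here in the eigenspaces
  -- of `F`: `(𝟙+F)⊗(4𝟙-E)/24 + (𝟙-F)⊗E/8`.
  have hpsd : ((1 / 24 : ℂ) • ((1 + ((1 : ℂ) * 2) • partialTranspose (phiPlus 2)) ⊗ₖ
        ((1 - E) + (3 : ℂ) • 1)) +
      (1 / 8 : ℂ) • ((1 + ((-1 : ℂ) * 2) • partialTranspose (phiPlus 2)) ⊗ₖ E)).PosSemidef :=
    (((posSemidef_one_add_smul_swap (Or.inl rfl)).kronecker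
      (hE1.add (PosSemidef.one.smul (by positivity)))).smul (by positivity)).add
    (((posSemidef_one_add_smul_swap (Or.inr rfl)).kronecker hE0).smul (by positivity))
  convert hpsd.submatrix (Equiv.prodProdProdComm (Fin 2) (Fin 2) a b).symm using 1
  rw [choi_measurePrepare, one_sub_testOperator, testOperator]
  ext ⟨⟨i, i'⟩, ⟨k, k'⟩⟩ ⟨⟨j, j'⟩, ⟨l, l'⟩⟩
  simp only [partialTranspose, regroup, hE, witness, Matrix.of_apply, reindex_apply,
    submatrix_apply, Equiv.prodProdProdComm_symm, Equiv.prodProdProdComm_apply, Matrix.add_apply,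
    Matrix.smul_apply, Matrix.sub_apply, kronecker_apply, transpose_apply, smul_eq_mul,
    vecMulVec_apply, Matrix.one_apply, Prod.mk.injEq, eq_comm (a := j),
    eq_comm (a := l')]
  ring

end

/-! ### Local measurements and protocols with classical communication -/

/-- Conjugation by a single operator. -/
def conjMap {d d' : Type*} [Fintype d] (V : Matrix d' d ℂ) :
    Matrix d d ℂ →ₗ[ℂ] Matrix d' d' ℂ := krausMap fun _ : Unit => V

theorem conjMap_apply {d d' : Type*} [Fintype d] (V : Matrix d' d ℂ) (X : Matrix d d ℂ) :
    conjMap V X = V * X * Vᴴ := by simp [conjMap, krausMap_apply]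

theorem tensorMap_conjMap {a b a' b' : Type*} [Fintype a] [DecidableEq a] [Fintype b]
    [DecidableEq b] [Fintype a'] [DecidableEq a'] [Fintype b'] [DecidableEq b']
    (V : Matrix a' a ℂ) (U : Matrix b' b ℂ) :
    tensorMap (conjMap V) (conjMap U) = conjMap (V ⊗ₖ U) := by
  ext1 X
  rw [conjMap, conjMap, tensorMap_krausMap, conjMap_apply]
  simp [krausMap_apply]

/-- Both parties measure, announce their outcomes and continue accordingly. -/
theorem exists_isLOCC_measure {a b c e a' b' ι κ : Type} [Fintype a] [DecidableEq a] [Fintype b]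
    [DecidableEq b] [Fintype c] [DecidableEq c] [Fintype e] [DecidableEq e] [Fintype a']
    [DecidableEq a'] [Fintype b'] [DecidableEq b'] [Fintype ι] [Fintype κ]
    {E : ι → (Matrix a a ℂ →ₗ[ℂ] Matrix c c ℂ)} (hE : IsInstrument E)
    {F : κ → (Matrix b b ℂ →ₗ[ℂ] Matrix e e ℂ)} (hF : IsInstrument F)
    {Λ : ι → κ → (Matrix (c × e) (c × e) ℂ →ₗ[ℂ] Matrix (a' × b') (a' × b') ℂ)}
    (hΛ : ∀ x y, IsLOCC (Λ x y)) :
    ∃ Ξ : Matrix (a × b) (a × b) ℂ →ₗ[ℂ] Matrix (a' × b') (a' × b') ℂ, IsLOCC Ξ ∧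
      ∀ X, Ξ X = ∑ x, ∑ y, Λ x y (tensorMap (E x) (F y) X) := by
  refine ⟨_, IsLOCC.alice E hE _ fun x => IsLOCC.bob F hF (Λ x) (hΛ x), fun X => ?_⟩
  rw [LinearMap.sum_apply]
  refine Finset.sum_congr rfl fun x _ => ?_
  rw [LinearMap.comp_apply, LinearMap.sum_apply]
  refine Finset.sum_congr rfl fun y _ => ?_
  rw [LinearMap.comp_apply]
  congr 1
  rw [← LinearMap.comp_apply]
  congr 1
  apply linearMap_ext_kronecker
  intro X Y
  simp [tensorMap_kronecker]

theorem IsChannel.isInstrument {d d' : Type*} [Fintype d] [DecidableEq d] [Fintype d']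
    [DecidableEq d'] {Φ : Matrix d d ℂ →ₗ[ℂ] Matrix d' d' ℂ} (h : IsChannel Φ) :
    IsInstrument fun _ : Unit => Φ :=
  ⟨fun _ => h.1, by simpa using h.2⟩

/-- Local channels may be applied before an LOCC protocol. -/
theorem IsLOCC.exists_comp_local {a b c e a' b' : Type} [Fintype a] [DecidableEq a] [Fintype b]
    [DecidableEq b] [Fintype c] [DecidableEq c] [Fintype e] [DecidableEq e] [Fintype a']
    [DecidableEq a'] [Fintype b'] [DecidableEq b']
    {Λ : Matrix (c × e) (c × e) ℂ →ₗ[ℂ] Matrix (a' × b') (a' × b') ℂ} (hΛ : IsLOCC Λ)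
    {Φ : Matrix a a ℂ →ₗ[ℂ] Matrix c c ℂ} (hΦ : IsChannel Φ)
    {Ψ : Matrix b b ℂ →ₗ[ℂ] Matrix e e ℂ} (hΨ : IsChannel Ψ) :
    ∃ Ξ : Matrix (a × b) (a × b) ℂ →ₗ[ℂ] Matrix (a' × b') (a' × b') ℂ, IsLOCC Ξ ∧
      ∀ X, Ξ X = Λ (tensorMap Φ Ψ X) := by
  obtain ⟨Ξ, h, hΞ⟩ := exists_isLOCC_measure hΦ.isInstrument hΨ.isInstrument
    (Λ := fun _ _ => Λ) fun _ _ => hΛ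
  exact ⟨Ξ, h, fun X => by simp [hΞ]⟩

/-- The tensor product of two bipartite operators, regarded as a bipartite operator. -/
def pairTensor {a b a' b' : Type*} :
    Matrix (a × b) (a × b) ℂ →ₗ[ℂ] Matrix (a' × b') (a' × b') ℂ →ₗ[ℂ]
      Matrix ((a × a') × (b × b')) ((a × a') × (b × b')) ℂ :=
  LinearMap.mk₂ ℂ
    (fun ρ σ => (ρ ⊗ₖ σ).submatrix (Equiv.prodProdProdComm a a' b b')
      (Equiv.prodProdProdComm a a' b b'))
    (fun ρ ρ' σ => by rw [add_kronecker]; rfl)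
    (fun c ρ σ => by rw [smul_kronecker]; rfl)
    (fun ρ σ σ' => by rw [kronecker_add]; rfl)
    (fun c ρ σ => by rw [kronecker_smul]; rfl)

theorem pairTensor_apply {a b a' b' : Type*} (ρ : Matrix (a × b) (a × b) ℂ)
    (σ : Matrix (a' × b') (a' × b') ℂ) (p q : (a × a') × (b × b')) :
    pairTensor ρ σ p q = ρ (p.1.1, p.2.1) (q.1.1, q.2.1) * σ (p.1.2, p.2.2) (q.1.2, q.2.2) := rfl

theorem pairTensor_kronecker {a b a' b' : Type*} (X : Matrix a a ℂ) (Y : Matrix b b ℂ)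
    (Z : Matrix a' a' ℂ) (U : Matrix b' b' ℂ) :
    pairTensor (X ⊗ₖ Y) (Z ⊗ₖ U) = (X ⊗ₖ Z) ⊗ₖ (Y ⊗ₖ U) := by
  ext ⟨⟨i, i'⟩, ⟨k, k'⟩⟩ ⟨⟨j, j'⟩, ⟨l, l'⟩⟩
  simp only [pairTensor_apply, kronecker_apply]
  ring

theorem bilinearMap_ext_kronecker {a b a' b' : Type*} [Fintype a] [DecidableEq a] [Fintype b]
    [DecidableEq b] [Fintype a'] [DecidableEq a'] [Fintype b'] [DecidableEq b']
    {M : Type*} [AddCommMonoid M] [Module ℂ M]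
    {f g : Matrix (a × b) (a × b) ℂ →ₗ[ℂ] Matrix (a' × b') (a' × b') ℂ →ₗ[ℂ] M}
    (h : ∀ X Y Z U, f (X ⊗ₖ Y) (Z ⊗ₖ U) = g (X ⊗ₖ Y) (Z ⊗ₖ U)) : f = g :=
  linearMap_ext_kronecker fun X Y => linearMap_ext_kronecker fun Z U => h X Y Z U

theorem tensorMap_pairTensor {a b a' b' c e c' e' : Type*} [Fintype a] [DecidableEq a] [Fintype b]
    [DecidableEq b] [Fintype a'] [DecidableEq a'] [Fintype b'] [DecidableEq b']
    [Fintype c] [DecidableEq c] [Fintype e] [DecidableEq e]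
    [Fintype c'] [DecidableEq c'] [Fintype e'] [DecidableEq e']
    (Φ : Matrix a a ℂ →ₗ[ℂ] Matrix c c ℂ) (Φ' : Matrix a' a' ℂ →ₗ[ℂ] Matrix c' c' ℂ)
    (Ψ : Matrix b b ℂ →ₗ[ℂ] Matrix e e ℂ) (Ψ' : Matrix b' b' ℂ →ₗ[ℂ] Matrix e' e' ℂ)
    (ρ : Matrix (a × b) (a × b) ℂ) (σ : Matrix (a' × b') (a' × b') ℂ) :
    tensorMap (tensorMap Φ Φ') (tensorMap Ψ Ψ') (pairTensor ρ σ) =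
      pairTensor (tensorMap Φ Ψ ρ) (tensorMap Φ' Ψ' σ) := by
  have h : pairTensor.compr₂ (tensorMap (tensorMap Φ Φ') (tensorMap Ψ Ψ')) =
      pairTensor.compl₁₂ (tensorMap Φ Ψ) (tensorMap Φ' Ψ') := by
    apply bilinearMap_ext_kronecker
    intro X Y Z U
    simp only [LinearMap.compr₂_apply, LinearMap.compl₁₂_apply, pairTensor_kronecker,
      tensorMap_kronecker]
  exact LinearMap.congr_fun (LinearMap.congr_fun h ρ) σ

/-- The partial trace over the second tensor factor. -/
def discardRight (c r : Type*) [Fintype c] [DecidableEq c] [Fintype r] [DecidableEq r] :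
    Matrix (c × r) (c × r) ℂ →ₗ[ℂ] Matrix c c ℂ :=
  krausMap fun s : r => (1 : Matrix (c × r) (c × r) ℂ).submatrix (fun i => (i, s)) id

/-- The partial trace over the first tensor factor. -/
def discardLeft (c r : Type*) [Fintype c] [DecidableEq c] [Fintype r] [DecidableEq r] :
    Matrix (c × r) (c × r) ℂ →ₗ[ℂ] Matrix r r ℂ :=
  krausMap fun s : c => (1 : Matrix (c × r) (c × r) ℂ).submatrix (fun i => (s, i)) id

theorem conj_submatrix_one {d d' : Type*} [Fintype d] [DecidableEq d] (g : d' → d)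
    (X : Matrix d d ℂ) : (1 : Matrix d d ℂ).submatrix g id * X *
      ((1 : Matrix d d ℂ).submatrix g id)ᴴ = X.submatrix g g := by
  ext i j
  simp [Matrix.mul_apply, Matrix.one_apply]

theorem discardRight_isChannel (c r : Type*) [Fintype c] [DecidableEq c] [Fintype r]
    [DecidableEq r] : IsChannel (discardRight c r) := by
  apply krausMap_isChannel
  ext ⟨i, k⟩ ⟨j, l⟩
  simp only [Matrix.sum_apply, Matrix.mul_apply, conjTranspose_apply, submatrix_apply, id,
    Matrix.one_apply]
  rw [Finset.sum_comm, ← Fintype.sum_prod_type']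
  rw [Finset.sum_eq_single (i, k)] <;> simp +contextual

theorem discardLeft_isChannel (c r : Type*) [Fintype c] [DecidableEq c] [Fintype r]
    [DecidableEq r] : IsChannel (discardLeft c r) := by
  apply krausMap_isChannel
  ext ⟨i, k⟩ ⟨j, l⟩
  simp only [Matrix.sum_apply, Matrix.mul_apply, conjTranspose_apply, submatrix_apply, id,
    Matrix.one_apply]
  rw [← Fintype.sum_prod_type']
  rw [Finset.sum_eq_single (i, k)] <;> simp +contextual

theorem discardRight_kronecker {c r : Type*} [Fintype c] [DecidableEq c] [Fintype r]
    [DecidableEq r] (X : Matrix c c ℂ) (Y : Matrix r r ℂ) :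
    discardRight c r (X ⊗ₖ Y) = Y.trace • X := by
  ext i j
  simp only [discardRight, krausMap_apply, conj_submatrix_one, Matrix.sum_apply, submatrix_apply,
    kronecker_apply, Matrix.smul_apply, smul_eq_mul, ← Finset.mul_sum, Matrix.trace, Matrix.diag]
  ring

theorem discardLeft_kronecker {c r : Type*} [Fintype c] [DecidableEq c] [Fintype r]
    [DecidableEq r] (X : Matrix c c ℂ) (Y : Matrix r r ℂ) :
    discardLeft c r (X ⊗ₖ Y) = X.trace • Y := by
  ext i j
  simp only [discardLeft, krausMap_apply, conj_submatrix_one, Matrix.sum_apply, submatrix_apply,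
    kronecker_apply, Matrix.smul_apply, smul_eq_mul, ← Finset.sum_mul, Matrix.trace, Matrix.diag]

theorem tensorMap_discardRight_pairTensor {a b a' b' : Type*} [Fintype a] [DecidableEq a]
    [Fintype b] [DecidableEq b] [Fintype a'] [DecidableEq a'] [Fintype b'] [DecidableEq b']
    (ρ : Matrix (a × b) (a × b) ℂ) (σ : Matrix (a' × b') (a' × b') ℂ) :
    tensorMap (discardRight a a') (discardRight b b') (pairTensor ρ σ) = σ.trace • ρ := by
  have h : pairTensor.compr₂ (tensorMap (discardRight a a') (discardRight b b')) =
      ((LinearMap.lsmul ℂ (Matrix (a × b) (a × b) ℂ)).flip.compl₂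
        (Matrix.traceLinearMap (a' × b') ℂ ℂ)) := by
    apply bilinearMap_ext_kronecker
    intro X Y Z U
    simp [pairTensor_kronecker, tensorMap_kronecker, discardRight_kronecker, trace_kronecker,
      smul_kronecker, kronecker_smul, smul_smul, mul_comm]
  exact LinearMap.congr_fun (LinearMap.congr_fun h ρ) σ

theorem tensorMap_discardLeft_pairTensor {a b a' b' : Type*} [Fintype a] [DecidableEq a]
    [Fintype b] [DecidableEq b] [Fintype a'] [DecidableEq a'] [Fintype b'] [DecidableEq b']
    (ρ : Matrix (a × b) (a × b) ℂ) (σ : Matrix (a' × b') (a' × b') ℂ) :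
    tensorMap (discardLeft a a') (discardLeft b b') (pairTensor ρ σ) = ρ.trace • σ := by
  have h : pairTensor.compr₂ (tensorMap (discardLeft a a') (discardLeft b b')) =
      ((LinearMap.lsmul ℂ (Matrix (a' × b') (a' × b') ℂ)).comp
        (Matrix.traceLinearMap (a × b) ℂ ℂ)) := by
    apply bilinearMap_ext_kronecker
    intro X Y Z U
    simp [pairTensor_kronecker, tensorMap_kronecker, discardLeft_kronecker, trace_kronecker,
      smul_kronecker, kronecker_smul, smul_smul, mul_comm]
  exact LinearMap.congr_fun (LinearMap.congr_fun h ρ) σ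

/-- A measurement with Kraus operators `k x` on the first factor of a composite local system. -/
theorem isInstrument_tensorMap_conjMap_id {q c r ι : Type*} [Fintype q] [DecidableEq q] [Fintype c]
    [DecidableEq c] [Fintype r] [DecidableEq r] [Fintype ι] {k : ι → Matrix c q ℂ}
    (hk : ∑ x, (k x)ᴴ * k x = 1) :
    IsInstrument fun x => tensorMap (conjMap (k x))
      (LinearMap.id : Matrix r r ℂ →ₗ[ℂ] Matrix r r ℂ) := by
  constructor
  · intro x
    change IsCompletelyPositive (tensorMap (krausMap fun _ : Unit => k x) LinearMap.id)
    rw [← krausMap_one, tensorMap_krausMap]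
    exact krausMap_isCompletelyPositive _
  · have h : Matrix.traceLinearMap (c × r) ℂ ℂ ∘ₗ (∑ x, tensorMap (conjMap (k x))
        (LinearMap.id : Matrix r r ℂ →ₗ[ℂ] Matrix r r ℂ)) = Matrix.traceLinearMap (q × r) ℂ ℂ := by
      apply linearMap_ext_kronecker
      intro X Y
      have h1 : ∑ x, (conjMap (k x) X).trace = X.trace := by
        have := krausMap_isTracePreserving hk X
        rw [krausMap_apply, trace_sum] at this
        simpa [conjMap_apply] using this
      simp [tensorMap_kronecker, trace_kronecker, ← Finset.sum_mul, h1]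
    exact fun X => LinearMap.congr_fun h X

theorem sum_trace_tensorMap_conjMap {q q' c c' ι κ : Type*} [Fintype q] [DecidableEq q]
    [Fintype q'] [DecidableEq q'] [Fintype c] [DecidableEq c] [Fintype c'] [DecidableEq c']
    [Fintype ι] [Fintype κ] {k : ι → Matrix c q ℂ} (hk : ∑ x, (k x)ᴴ * k x = 1)
    {l : κ → Matrix c' q' ℂ} (hl : ∑ x, (l x)ᴴ * l x = 1) (ρ : Matrix (q × q') (q × q') ℂ) :
    ∑ x, ∑ y, (tensorMap (conjMap (k x)) (conjMap (l y)) ρ).trace = ρ.trace := by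
  have h : ∑ p : ι × κ, (k p.1 ⊗ₖ l p.2)ᴴ * (k p.1 ⊗ₖ l p.2) = 1 := by
    simp only [conjTranspose_kronecker, ← mul_kronecker_mul, Fintype.sum_prod_type]
    rw [← one_kronecker_one, ← hk, ← hl]
    ext ⟨i, j⟩ ⟨i', j'⟩
    simp [Matrix.sum_apply, Finset.sum_mul_sum]
  rw [← krausMap_isTracePreserving h ρ, krausMap_apply, trace_sum, Fintype.sum_prod_type]
  simp only [tensorMap_conjMap, conjMap_apply]

/-- One round of filtering: if both filters succeed on the first pair of systems, the filtered
state is kept, otherwise the protocol `Λ` is run on the second pair. -/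
theorem IsLOCC.exists_filter_step {q q' r r' a' b' ι κ : Type} [Fintype q] [DecidableEq q]
    [Fintype q'] [DecidableEq q'] [Fintype r] [DecidableEq r] [Fintype r'] [DecidableEq r']
    [Fintype a'] [DecidableEq a'] [Fintype b'] [DecidableEq b'] [Fintype ι] [Fintype κ]
    [DecidableEq ι] [DecidableEq κ]
    {k : ι → Matrix a' q ℂ} (hk : ∑ x, (k x)ᴴ * k x = 1)
    {l : κ → Matrix b' q' ℂ} (hl : ∑ x, (l x)ᴴ * l x = 1) (x₀ : ι) (y₀ : κ)
    {Λ : Matrix (r × r') (r × r') ℂ →ₗ[ℂ] Matrix (a' × b') (a' × b') ℂ} (hΛ : IsLOCC Λ) :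
    ∃ Ξ : Matrix ((q × r) × (q' × r')) ((q × r) × (q' × r')) ℂ →ₗ[ℂ]
      Matrix (a' × b') (a' × b') ℂ, IsLOCC Ξ ∧ ∀ ρ τ, Ξ (pairTensor ρ τ) =
        τ.trace • tensorMap (conjMap (k x₀)) (conjMap (l y₀)) ρ +
        (ρ.trace - (tensorMap (conjMap (k x₀)) (conjMap (l y₀)) ρ).trace) • Λ τ := by
  obtain ⟨Λ', hΛ', hΛ'eq⟩ := hΛ.exists_comp_local (discardLeft_isChannel a' r)
    (discardLeft_isChannel b' r')
  obtain ⟨Ξ, hΞ, hΞeq⟩ := exists_isLOCC_measure (isInstrument_tensorMap_conjMap_id (r := r) hk)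
    (isInstrument_tensorMap_conjMap_id (r := r') hl)
    (Λ := fun x y => if x = x₀ ∧ y = y₀ then
      tensorMap (discardRight a' r) (discardRight b' r') else Λ') (fun x y => by
        split_ifs
        · exact IsLOCC.localOps _ _ (discardRight_isChannel _ _) (discardRight_isChannel _ _)
        · exact hΛ')
  refine ⟨Ξ, hΞ, fun ρ τ => ?_⟩
  set t : ι → κ → ℂ := fun x y => (tensorMap (conjMap (k x)) (conjMap (l y)) ρ).trace with ht
  have hid : tensorMap (LinearMap.id : Matrix r r ℂ →ₗ[ℂ] Matrix r r ℂ)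
      (LinearMap.id : Matrix r' r' ℂ →ₗ[ℂ] Matrix r' r' ℂ) τ = τ := by
    have : tensorMap (LinearMap.id : Matrix r r ℂ →ₗ[ℂ] Matrix r r ℂ)
      (LinearMap.id : Matrix r' r' ℂ →ₗ[ℂ] Matrix r' r' ℂ) = LinearMap.id :=
      linearMap_ext_kronecker fun X Y => by simp [tensorMap_kronecker]
    rw [this]; rfl
  -- Every outcome is written as a failure plus a correction supported on `(x₀, y₀)`, so the total
  -- over outcomes collapses using only that the probabilities add up to `Tr ρ`.
  have hterm : ∀ x y, (if x = x₀ ∧ y = y₀ then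
      tensorMap (discardRight a' r) (discardRight b' r') else Λ')
        (tensorMap (tensorMap (conjMap (k x)) LinearMap.id)
          (tensorMap (conjMap (l y)) LinearMap.id) (pairTensor ρ τ)) =
      t x y • Λ τ + (if x = x₀ then (if y = y₀ then
        (τ.trace • tensorMap (conjMap (k x₀)) (conjMap (l y₀)) ρ - t x₀ y₀ • Λ τ) else 0) else 0)
      := by
    intro x y
    rw [tensorMap_pairTensor, hid]
    by_cases h : x = x₀ ∧ y = y₀
    · obtain ⟨rfl, rfl⟩ := h
      simp [tensorMap_discardRight_pairTensor]
    · rw [if_neg h, hΛ'eq, tensorMap_discardLeft_pairTensor, map_smul, ← ite_and, if_neg h,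
        add_zero]
  rw [hΞeq]
  simp only [hterm, Finset.sum_add_distrib, ← Finset.sum_smul]
  rw [ht, sum_trace_tensorMap_conjMap hk hl]
  simp
  module

/-- A contraction is one of the Kraus operators of a measurement. -/
theorem exists_measurement_of_contraction {q c : Type*} [Fintype q] [DecidableEq q] [Fintype c]
    [Nonempty c] {K : Matrix c q ℂ} (hK : (1 - Kᴴ * K).PosSemidef) :
    ∃ k : Option q → Matrix c q ℂ, ∑ x, (k x)ᴴ * k x = 1 ∧ k none = K := by
  classical
  obtain ⟨S, hS⟩ := exists_eq_conjTranspose_mul_self hK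
  obtain ⟨c₀⟩ := ‹Nonempty c›
  -- The failure operators are the rows of `S`, each placed in the single row `c₀`; their squares
  -- add up to `S*S = 1 - K*K`.
  refine ⟨fun x => x.elim K fun f => Matrix.of fun i j => if i = c₀ then S f j else 0, ?_, rfl⟩
  rw [Fintype.sum_option]
  have : ∑ f : q, (Matrix.of fun i j => if i = c₀ then S f j else 0 : Matrix c q ℂ)ᴴ *
      (Matrix.of fun i j => if i = c₀ then S f j else 0 : Matrix c q ℂ) = Sᴴ * S := by
    ext i j
    simp [Matrix.sum_apply, Matrix.mul_apply]
  simp only [Option.elim]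
  rw [this, ← hS]
  simp

/-! ### Trace norm estimates -/

theorem traceNorm_nonneg {d : Type*} [Fintype d] [DecidableEq d] (X : Matrix d d ℂ) :
    0 ≤ traceNorm X := Finset.sum_nonneg fun _ _ => Real.sqrt_nonneg _

/-- Cauchy–Schwarz on the singular values. -/
theorem traceNorm_sq_le {d : Type*} [Fintype d] [DecidableEq d] (X : Matrix d d ℂ) :
    traceNorm X ^ 2 ≤ Fintype.card d * (Xᴴ * X).trace.re := by
  have h := (isHermitian_conjTranspose_mul_self X).trace_eq_sum_eigenvalues
  have h0 : ∀ i, 0 ≤ (isHermitian_conjTranspose_mul_self X).eigenvalues i :=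
    (posSemidef_conjTranspose_mul_self X).eigenvalues_nonneg
  have h1 : (Xᴴ * X).trace.re = ∑ i, (isHermitian_conjTranspose_mul_self X).eigenvalues i := by
    rw [h]; simp
  rw [h1, traceNorm]
  refine (sq_sum_le_card_mul_sum_sq (s := Finset.univ)).trans (le_of_eq ?_)
  simp only [Real.sq_sqrt (h0 _), Finset.card_univ]

/-- A Lagrange identity: the difference is half the sum of the rank-one operators of the
antisymmetrised rows of `S`, where `G = S*S`. It yields `Tr D² ≤ 1` for states and a scale making
any operator a contraction. -/
theorem posSemidef_trace_smul_one_sub {d : Type*} [Fintype d] [DecidableEq d] {G : Matrix d d ℂ}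
    (hG : G.PosSemidef) : (G.trace • (1 : Matrix d d ℂ) - G).PosSemidef := by
  obtain ⟨S, rfl⟩ := exists_eq_conjTranspose_mul_self hG
  set z : d → d → d → d → ℂ := fun k i j p =>
    S k i * (if p = j then 1 else 0) - S k j * (if p = i then 1 else 0) with hz
  have hpsd : ((1 / 2 : ℂ) • ∑ k, ∑ i, ∑ j, vecMulVec (z k i j) (star (z k i j))).PosSemidef :=
    (posSemidef_sum _ fun k _ => posSemidef_sum _ fun i _ => posSemidef_sum _ fun j _ =>
      posSemidef_vecMulVec_self_star _).smul (by positivity)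
  convert hpsd using 1
  ext r s
  simp only [Matrix.sub_apply, Matrix.smul_apply, Matrix.sum_apply, vecMulVec_apply, Pi.star_apply,
    smul_eq_mul, hz, mul_sub, sub_mul, star_sub, Finset.sum_sub_distrib,
    apply_ite star, star_zero, ite_mul, mul_ite, zero_mul, mul_zero, mul_one,
    Finset.sum_ite_eq, Finset.mem_univ, if_true, Matrix.trace, Matrix.diag, Matrix.mul_apply,
    conjTranspose_apply, Matrix.one_apply]
  by_cases h : r = s
  · subst h
    simp [Finset.sum_ite_irrel]
    rw [Finset.sum_comm]
    simp only [mul_comm ((starRingEnd ℂ) _)]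
    ring
  · simp [h]
    simp only [mul_comm ((starRingEnd ℂ) _)]
    ring

/-- The squared Hilbert–Schmidt distance is `Tr D² - 2F + 1 ≤ 2(1 - F)`, with `F` the fidelity; the
dimension `4` turns `2` into `8`. -/
theorem traceNorm_sub_phiPlus_sq_le {D : Matrix (Fin 2 × Fin 2) (Fin 2 × Fin 2) ℂ}
    (hD : IsState D) :
    traceNorm (D - phiPlus 2) ^ 2 ≤ 8 * (1 - (phiPlus 2 * D).trace.re) := by
  refine (traceNorm_sq_le _).trans ?_
  have hH : (D - phiPlus 2)ᴴ = D - phiPlus 2 :=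
    (hD.1.isHermitian.sub (phiPlus_posSemidef 2).isHermitian)
  have h1 : 0 ≤ D.trace.re - (D * D).trace.re := by
    have h := posSemidef_trace_smul_one_sub hD.1
    have h2 := trace_mul_nonneg h hD.1
    rw [hD.2, one_smul, sub_mul, one_mul, trace_sub] at h2
    have := (Complex.le_def.mp h2).1
    simpa using this
  rw [hD.2, Complex.one_re] at h1
  have h2 : ((D - phiPlus 2)ᴴ * (D - phiPlus 2)).trace.re =
      (D * D).trace.re - 2 * (phiPlus 2 * D).trace.re + 1 := by
    rw [hH, sub_mul, mul_sub, mul_sub, phiPlus_two_mul_self, trace_sub, trace_sub, trace_sub,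
      trace_phiPlus_two, trace_mul_comm D (phiPlus 2)]
    simp only [Complex.sub_re, Complex.one_re]
    ring
  rw [h2]
  simp only [Fintype.card_prod, Fintype.card_fin, Nat.cast_mul, Nat.cast_ofNat]
  linarith

/-- A near-optimal choice in every term of a sequence. -/
theorem exists_seq_tendsto_zero {α : ℕ → Type*} {P : ∀ n, α n → Prop} {f : ∀ n, α n → ℝ}
    (hP : ∀ n, ∃ x, P n x) (hf : ∀ n x, 0 ≤ f n x)
    (h : ∀ ε > 0, ∀ᶠ n in atTop, ∃ x, P n x ∧ f n x ≤ ε) :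
    ∃ x : ∀ n, α n, (∀ n, P n (x n)) ∧ Tendsto (fun n => f n (x n)) atTop (𝓝 0) := by
  -- The infimum need not be attained, so a slack vanishing with `n` is allowed. One sequence then
  -- serves every `ε`.
  have hinf : ∀ n, ∃ x, P n x ∧ ∀ y, P n y → f n x ≤ f n y + 1 / ((n : ℝ) + 1) := by
    intro n
    set S := f n '' {x | P n x} with hS
    have hne : S.Nonempty := by obtain ⟨x, hx⟩ := hP n; exact ⟨_, x, hx, rfl⟩
    have hb : BddBelow S := ⟨0, by rintro _ ⟨x, -, rfl⟩; exact hf n x⟩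
    obtain ⟨_, ⟨x, hx, rfl⟩, hlt⟩ := Real.lt_sInf_add_pos hne
      (show (0 : ℝ) < 1 / ((n : ℝ) + 1) by positivity)
    exact ⟨x, hx, fun y hy => hlt.le.trans (by gcongr; exact csInf_le hb ⟨y, hy, rfl⟩)⟩
  choose x hx hx' using hinf
  refine ⟨x, hx, ?_⟩
  rw [Metric.tendsto_atTop]
  intro ε hε
  have h2 := (tendsto_one_div_add_atTop_nhds_zero_nat (𝕜 := ℝ)).eventually
    (gt_mem_nhds (show (0 : ℝ) < ε / 2 by positivity))
  obtain ⟨N, hN⟩ := eventually_atTop.mp ((h (ε / 2) (by positivity)).and h2)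
  refine ⟨N, fun n hn => ?_⟩
  obtain ⟨⟨y, hy, hy'⟩, h3⟩ := hN n hn
  rw [Real.dist_0_eq_abs, abs_of_nonneg (hf n _)]
  linarith [hx' n y hy]

/-! ### Repeated filtering -/

/-- The operator `D` is obtained from `n` copies of `ω` by an LOCC protocol. -/
def LOCCReaches {a b : Type} [Fintype a] [DecidableEq a] [Fintype b] [DecidableEq b]
    (ω : Matrix (a × b) (a × b) ℂ) (n : ℕ) (D : Matrix (Fin 2 × Fin 2) (Fin 2 × Fin 2) ℂ) : Prop :=
  ∃ Λ : Matrix ((Fin n → a) × (Fin n → b)) ((Fin n → a) × (Fin n → b)) ℂ →ₗ[ℂ]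
    Matrix (Fin 2 × Fin 2) (Fin 2 × Fin 2) ℂ, IsLOCC Λ ∧ Λ (tensorPower ω n) = D

theorem trace_tensorPower {a b : Type*} [Fintype a] [Fintype b]
    (ω : Matrix (a × b) (a × b) ℂ) (n : ℕ) : (tensorPower ω n).trace = ω.trace ^ n := by
  simp only [Matrix.trace, Matrix.diag, tensorPower, Matrix.of_apply]
  rw [← Equiv.sum_comp (Equiv.arrowProdEquivProdArrow (Fin n) (fun _ => a) (fun _ => b)),
    ← Fin.prod_const, Finset.prod_univ_sum]
  simp [Equiv.arrowProdEquivProdArrow]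

theorem conjMap_submatrix_one_isChannel {d d' : Type*} [Fintype d] [DecidableEq d] [Fintype d']
    [DecidableEq d'] (e : d' ≃ d) : IsChannel (conjMap ((1 : Matrix d d ℂ).submatrix e id)) := by
  apply krausMap_isChannel
  ext i j
  simp only [Finset.univ_unique, Finset.sum_const, Finset.card_singleton, one_smul,
    Matrix.mul_apply, conjTranspose_apply, submatrix_apply, id, Matrix.one_apply]
  rw [e.sum_comp (fun x => star (if x = i then (1 : ℂ) else 0) * if x = j then 1 else 0)]
  simp [eq_comm]

theorem tensorMap_conjMap_submatrix_one {c c' e e' : Type*} [Fintype c] [DecidableEq c] [Fintype c']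
    [DecidableEq c'] [Fintype e] [DecidableEq e] [Fintype e'] [DecidableEq e'] (g : c' → c)
    (g' : e' → e) (X : Matrix (c × e) (c × e) ℂ) :
    tensorMap (conjMap ((1 : Matrix c c ℂ).submatrix g id))
      (conjMap ((1 : Matrix e e ℂ).submatrix g' id)) X =
      X.submatrix (Prod.map g g') (Prod.map g g') := by
  have : (1 : Matrix c c ℂ).submatrix g id ⊗ₖ (1 : Matrix e e ℂ).submatrix g' id =
      (1 : Matrix (c × e) (c × e) ℂ).submatrix (Prod.map g g') id := by
    rw [← one_kronecker_one]; rfl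
  rw [tensorMap_conjMap, this, conjMap_apply, conj_submatrix_one]

theorem tensorPower_add_submatrix {a b : Type*} (ω : Matrix (a × b) (a × b) ℂ) (m n : ℕ) :
    (tensorPower ω (m + n)).submatrix (Prod.map (Fin.appendEquiv m n) (Fin.appendEquiv m n))
      (Prod.map (Fin.appendEquiv m n) (Fin.appendEquiv m n)) =
      pairTensor (tensorPower ω m) (tensorPower ω n) := by
  ext p q
  simp [tensorPower, pairTensor_apply, Fin.prod_univ_add, Fin.appendEquiv]

section

variable {a b : Type} [Fintype a] [DecidableEq a] [Fintype b] [DecidableEq b]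

/-- The fallback protocol, preparing `|00⟩`, used once the copies for filtering are exhausted. -/
theorem loccReaches_discard {ω : Matrix (a × b) (a × b) ℂ} (hω : ω.trace = 1) (n : ℕ) :
    LOCCReaches ω n (Matrix.single (0, 0) (0, 0) 1) := by
  have hch : ∀ d : Type, ∀ [Fintype d] [DecidableEq d], IsChannel
      (prepareMap (1 : Matrix d d ℂ) (Matrix.single 0 0 1 : Matrix (Fin 2) (Fin 2) ℂ)) := by
    intro d _ _
    refine ⟨prepareMap_isCompletelyPositive PosSemidef.one ?_, fun X => ?_⟩
    · rw [← diagonal_single]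
      refine PosSemidef.diagonal fun i => ?_
      fin_cases i <;> simp
    · simp [prepareMap, Matrix.trace_single_eq_same]
  refine ⟨_, IsLOCC.localOps _ _ (hch _) (hch _), ?_⟩
  have h : tensorMap (prepareMap (1 : Matrix (Fin n → a) (Fin n → a) ℂ)
        (Matrix.single 0 0 1 : Matrix (Fin 2) (Fin 2) ℂ))
      (prepareMap (1 : Matrix (Fin n → b) (Fin n → b) ℂ)
        (Matrix.single 0 0 1 : Matrix (Fin 2) (Fin 2) ℂ)) =
      prepareMap 1 (Matrix.single (0, 0) (0, 0) 1) := by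
    apply linearMap_ext_kronecker
    intro X Y
    simp [tensorMap_kronecker, prepareMap, trace_kronecker, single_kronecker_single, mul_comm]
  rw [h]
  simp [prepareMap, trace_tensorPower, hω]

/-- The first `N` copies are filtered; on failure the other `n`, still untouched, go to the protocol
producing `D`. -/
theorem LOCCReaches.filter_step {ω : Matrix (a × b) (a × b) ℂ} (hω : ω.trace = 1) {N n : ℕ}
    {K : Matrix (Fin 2) (Fin N → a) ℂ} (hK : (1 - Kᴴ * K).PosSemidef)
    {L : Matrix (Fin 2) (Fin N → b) ℂ} (hL : (1 - Lᴴ * L).PosSemidef)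
    {D : Matrix (Fin 2 × Fin 2) (Fin 2 × Fin 2) ℂ} (hD : LOCCReaches ω n D) :
    LOCCReaches ω (N + n) (tensorMap (conjMap K) (conjMap L) (tensorPower ω N) +
      (1 - (tensorMap (conjMap K) (conjMap L) (tensorPower ω N)).trace) • D) := by
  obtain ⟨Λ, hΛ, rfl⟩ := hD
  obtain ⟨k, hk, rfl⟩ := exists_measurement_of_contraction hK
  obtain ⟨l, hl, rfl⟩ := exists_measurement_of_contraction hL
  obtain ⟨Ξ, hΞ, hΞeq⟩ := hΛ.exists_filter_step hk hl none none
  obtain ⟨Ξ', hΞ', hΞ'eq⟩ := hΞ.exists_comp_local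
    (conjMap_submatrix_one_isChannel (Fin.appendEquiv (α := a) N n))
    (conjMap_submatrix_one_isChannel (Fin.appendEquiv (α := b) N n))
  refine ⟨Ξ', hΞ', ?_⟩
  rw [hΞ'eq, tensorMap_conjMap_submatrix_one, tensorPower_add_submatrix, hΞeq, trace_tensorPower,
    trace_tensorPower, hω]
  simp

end

/-- The `m`-fold tensor power of a matrix. -/
def piKron {r s : Type*} (M : Matrix r s ℂ) (m : ℕ) : Matrix (Fin m → r) (Fin m → s) ℂ :=
  Matrix.of fun p q => ∏ k, M (p k) (q k)

theorem piKron_mul {r s t : Type*} [Fintype s] (M : Matrix r s ℂ) (M' : Matrix s t ℂ) (m : ℕ) :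
    piKron M m * piKron M' m = piKron (M * M') m := by
  classical
  ext p q
  simp only [piKron, Matrix.mul_apply, Matrix.of_apply, ← Finset.prod_mul_distrib,
    Finset.prod_univ_sum, Fintype.piFinset_univ]

theorem conjTranspose_piKron {r s : Type*} (M : Matrix r s ℂ) (m : ℕ) :
    (piKron M m)ᴴ = piKron Mᴴ m := by
  ext p q
  simp [piKron, conjTranspose_apply]

theorem tensorPower_eq_submatrix_piKron {a b : Type*} (ω : Matrix (a × b) (a × b) ℂ) (m : ℕ) :
    tensorPower ω m = (piKron ω m).submatrix
      (Equiv.arrowProdEquivProdArrow (Fin m) (fun _ => a) (fun _ => b)).symm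
      (Equiv.arrowProdEquivProdArrow (Fin m) (fun _ => a) (fun _ => b)).symm := rfl

theorem piKron_kronecker {a b c e : Type*} (M : Matrix a c ℂ) (M' : Matrix b e ℂ) (m : ℕ) :
    piKron M m ⊗ₖ piKron M' m = (piKron (M ⊗ₖ M') m).submatrix
      (Equiv.arrowProdEquivProdArrow (Fin m) (fun _ => a) (fun _ => b)).symm
      (Equiv.arrowProdEquivProdArrow (Fin m) (fun _ => c) (fun _ => e)).symm := by
  ext p q
  simp [piKron, Finset.prod_mul_distrib, Equiv.arrowProdEquivProdArrow]

theorem tensorPower_posSemidef {a b : Type*} [Fintype a] [Fintype b]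
    {ω : Matrix (a × b) (a × b) ℂ} (hω : ω.PosSemidef) (m : ℕ) :
    (tensorPower ω m).PosSemidef := by
  obtain ⟨S, rfl⟩ := exists_eq_conjTranspose_mul_self hω
  rw [tensorPower_eq_submatrix_piKron, ← piKron_mul, ← conjTranspose_piKron]
  exact (posSemidef_conjTranspose_mul_self _).submatrix _

theorem tensorMap_conjMap_piKron {a b c e : Type*} [Fintype a] [DecidableEq a] [Fintype b]
    [DecidableEq b] [Fintype c] [DecidableEq c] [Fintype e] [DecidableEq e]
    (M : Matrix c a ℂ) (M' : Matrix e b ℂ) (ω : Matrix (a × b) (a × b) ℂ) (m : ℕ) :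
    tensorMap (conjMap (piKron M m)) (conjMap (piKron M' m)) (tensorPower ω m) =
      tensorPower (tensorMap (conjMap M) (conjMap M') ω) m := by
  rw [tensorMap_conjMap, conjMap_apply, piKron_kronecker, tensorPower_eq_submatrix_piKron,
    submatrix_mul_equiv, conjTranspose_submatrix, submatrix_mul_equiv, conjTranspose_piKron,
    piKron_mul, piKron_mul, tensorMap_conjMap, conjMap_apply, tensorPower_eq_submatrix_piKron]

theorem tensorMap_conjMap_mul {a b c e a' b' : Type*} [Fintype a] [DecidableEq a] [Fintype b]
    [DecidableEq b] [Fintype c] [DecidableEq c] [Fintype e] [DecidableEq e] [Fintype a']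
    [DecidableEq a'] [Fintype b'] [DecidableEq b']
    (M : Matrix c a ℂ) (L : Matrix a a' ℂ) (M' : Matrix e b ℂ) (L' : Matrix b b' ℂ)
    (X : Matrix (a' × b') (a' × b') ℂ) :
    tensorMap (conjMap (M * L)) (conjMap (M' * L')) X =
      tensorMap (conjMap M) (conjMap M') (tensorMap (conjMap L) (conjMap L') X) := by
  simp only [tensorMap_conjMap, conjMap_apply, mul_kronecker_mul, conjTranspose_mul,
    Matrix.mul_assoc]

theorem tensorMap_conjMap_posSemidef {a b a' b' : Type*} [Fintype a] [DecidableEq a] [Fintype b]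
    [DecidableEq b] [Fintype a'] [DecidableEq a'] [Fintype b'] [DecidableEq b']
    (K : Matrix a' a ℂ) (L : Matrix b' b ℂ) {X : Matrix (a × b) (a × b) ℂ} (hX : X.PosSemidef) :
    (tensorMap (conjMap K) (conjMap L) X).PosSemidef := by
  rw [tensorMap_conjMap, conjMap_apply]
  exact hX.mul_mul_conjTranspose_same _

/-- Local contractions do not increase the trace. -/
theorem trace_tensorMap_conjMap_le {a b a' b' : Type*} [Fintype a] [DecidableEq a] [Fintype b]
    [DecidableEq b] [Fintype a'] [DecidableEq a'] [Fintype b'] [DecidableEq b']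
    {K : Matrix a' a ℂ} (hK : (1 - Kᴴ * K).PosSemidef) {L : Matrix b' b ℂ}
    (hL : (1 - Lᴴ * L).PosSemidef) {X : Matrix (a × b) (a × b) ℂ} (hX : X.PosSemidef) :
    (tensorMap (conjMap K) (conjMap L) X).trace ≤ X.trace := by
  have h : ((1 - Kᴴ * K) ⊗ₖ (1 : Matrix b b ℂ) + (Kᴴ * K) ⊗ₖ (1 - Lᴴ * L)).PosSemidef :=
    (hK.kronecker PosSemidef.one).add ((posSemidef_conjTranspose_mul_self K).kronecker hL)
  have h' := trace_mul_nonneg h hX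
  have e : (1 - Kᴴ * K) ⊗ₖ (1 : Matrix b b ℂ) + (Kᴴ * K) ⊗ₖ (1 - Lᴴ * L) =
      1 - (K ⊗ₖ L)ᴴ * (K ⊗ₖ L) := by
    rw [conjTranspose_kronecker, ← mul_kronecker_mul, ← one_kronecker_one]
    ext ⟨i, j⟩ ⟨i', j'⟩
    simp only [Matrix.add_apply, Matrix.sub_apply, kronecker_apply]
    ring
  rw [e, sub_mul, one_mul, trace_sub, sub_nonneg] at h'
  rwa [tensorMap_conjMap, conjMap_apply, trace_mul_comm, ← Matrix.mul_assoc]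

/-- Since `K*K ≤ Tr(K*K)·1`, the factor `t = (1 + Tr K*K)^(-1/2)` works. Rescaling a filter changes
only its success probability, not the normalised output. -/
theorem exists_smul_contraction {q c : Type*} [Fintype q] [DecidableEq q] [Fintype c]
    (K : Matrix c q ℂ) : ∃ t : ℝ, 0 < t ∧
      (1 - ((t : ℂ) • K)ᴴ * ((t : ℂ) • K)).PosSemidef := by
  have hG := posSemidef_conjTranspose_mul_self K
  have hg : 0 ≤ (Kᴴ * K).trace.re := (Complex.le_def.mp hG.trace_nonneg).1
  have hg' : ((Kᴴ * K).trace.re : ℂ) = (Kᴴ * K).trace :=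
    Complex.ext rfl (Complex.le_def.mp hG.trace_nonneg).2
  set g := (Kᴴ * K).trace.re with hgdef
  refine ⟨Real.sqrt (1 + g)⁻¹, Real.sqrt_pos.mpr (by positivity), ?_⟩
  have ht : ((Real.sqrt (1 + g)⁻¹ : ℝ) : ℂ) * ((Real.sqrt (1 + g)⁻¹ : ℝ) : ℂ) =
      ((1 + g)⁻¹ : ℝ) := by
    rw [← Complex.ofReal_mul, Real.mul_self_sqrt (by positivity)]
  have hne : (1 + g : ℂ) ≠ 0 := by
    have : (1 + g : ℝ) ≠ 0 := by positivity
    exact_mod_cast this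
  have : 1 - (((Real.sqrt (1 + g)⁻¹ : ℝ) : ℂ) • K)ᴴ * (((Real.sqrt (1 + g)⁻¹ : ℝ) : ℂ) • K) =
      (((1 + g)⁻¹ : ℝ) : ℂ) • (1 + ((Kᴴ * K).trace • 1 - Kᴴ * K)) := by
    rw [conjTranspose_smul, Matrix.smul_mul, Matrix.mul_smul, smul_smul, RCLike.star_def,
      Complex.conj_ofReal, ht, ← hg']
    have h1 : (1 : Matrix q q ℂ) = (((1 + g)⁻¹ : ℝ) : ℂ) • ((1 + g : ℂ) • 1) := by
      rw [smul_smul]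
      push_cast
      rw [inv_mul_cancel₀ hne, one_smul]
    conv_lhs => rw [h1]
    module
  rw [this]
  exact (PosSemidef.one.add (posSemidef_trace_smul_one_sub hG)).smul
    (by exact_mod_cast (by positivity : 0 ≤ (1 + g)⁻¹))

/-! ### The filter for isotropic states -/

/-- The (unnormalised) Hadamard matrix. -/
def hadamardMatrix : Matrix (Fin 2) (Fin 2) ℂ := !![1, 1; 1, -1]

/-- The projection onto the code space of the concatenation of an `n`-qubit repetition code with
an `m`-qubit repetition code in the conjugate basis. -/
def codeFilter (m n : ℕ) : Matrix (Fin 2) (Fin (m * n) → Fin 2) ℂ :=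
  (1 : Matrix (Fin m → Fin 2) (Fin m → Fin 2) ℂ).submatrix
      (fun (s : Fin 2) (_ : Fin m) => s) id *
    (piKron hadamardMatrix m *
      (1 : Matrix (Fin (m * n) → Fin 2) (Fin (m * n) → Fin 2) ℂ).submatrix
        (fun (f : Fin m → Fin 2) (k : Fin (m * n)) => f (finProdFinEquiv.symm k).1) id)

/-- Restricting to constant strings turns a tensor power into an entrywise power. The inner code
gives entrywise `n`-th powers, the Hadamard matrices change basis, and the outer code gives
entrywise `m`-th powers. -/
theorem tensorMap_codeFilter_apply (ω : Matrix (Fin 2 × Fin 2) (Fin 2 × Fin 2) ℂ) (m n : ℕ)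
    (p q : Fin 2 × Fin 2) :
    tensorMap (conjMap (codeFilter m n)) (conjMap (codeFilter m n)) (tensorPower ω (m * n)) p q =
      (tensorMap (conjMap hadamardMatrix) (conjMap hadamardMatrix)
        (Matrix.of fun p q => ω p q ^ n) p q) ^ m := by
  have h : (tensorPower ω (m * n)).submatrix
      (Prod.map (fun (f : Fin m → Fin 2) k => f (finProdFinEquiv.symm k).1)
        (fun (f : Fin m → Fin 2) k => f (finProdFinEquiv.symm k).1))
      (Prod.map (fun (f : Fin m → Fin 2) k => f (finProdFinEquiv.symm k).1)
        (fun (f : Fin m → Fin 2) k => f (finProdFinEquiv.symm k).1)) =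
      tensorPower (Matrix.of fun p q => ω p q ^ n) m := by
    ext p q
    simp only [tensorPower, submatrix_apply, Matrix.of_apply, Prod.map]
    rw [finProdFinEquiv.symm.prod_comp
      (fun k : Fin m × Fin n => ω (p.1 k.1, p.2 k.1) (q.1 k.1, q.2 k.1)), Fintype.prod_prod_type]
    simp
  rw [codeFilter, tensorMap_conjMap_mul, tensorMap_conjMap_mul, tensorMap_conjMap_submatrix_one,
    tensorMap_conjMap_submatrix_one, h, tensorMap_conjMap_piKron]
  simp [tensorPower]

/-- The isotropic operator `x 𝟙 + 2 y φ₂⁺`. -/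
def isotropic (x y : ℝ) : Matrix (Fin 2 × Fin 2) (Fin 2 × Fin 2) ℂ :=
  (x : ℂ) • 1 + (2 * y : ℂ) • phiPlus 2

/-- The nonzero entries of the isotropic operator are among `x + y`, `x` and `y`, hence the three
powers. The condition `n ≠ 0` keeps the zero entries zero. -/
theorem tensorMap_hadamard_isotropic_pow (x y : ℝ) {n : ℕ} (hn : n ≠ 0) :
    tensorMap (conjMap hadamardMatrix) (conjMap hadamardMatrix)
        (Matrix.of fun p q => isotropic x y p q ^ n) =
      Matrix.of fun p q => if p = q then
          (if p.1 = p.2 then ((2 * ((x + y) ^ n + x ^ n + y ^ n) : ℝ) : ℂ)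
            else ((2 * ((x + y) ^ n + x ^ n - y ^ n) : ℝ) : ℂ))
        else if p.1 + p.2 = q.1 + q.2 then
          (if p.1 = p.2 then ((2 * ((x + y) ^ n - x ^ n + y ^ n) : ℝ) : ℂ)
            else ((2 * ((x + y) ^ n - x ^ n - y ^ n) : ℝ) : ℂ))
        else 0 := by
  rw [tensorMap_conjMap, conjMap_apply]
  ext ⟨i, k⟩ ⟨j, l⟩
  simp only [Matrix.mul_apply, conjTranspose_apply, kronecker_apply, Matrix.of_apply, isotropic,
    Fintype.sum_prod_type, Fin.sum_univ_two, hadamardMatrix, phiPlus_two_apply, Matrix.add_apply,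
    Matrix.smul_apply, Matrix.one_apply, smul_eq_mul]
  fin_cases i <;> fin_cases j <;> fin_cases k <;> fin_cases l <;> simp [hn] <;> ring

theorem trace_codeFilter_isotropic (x y : ℝ) {m n : ℕ} (hn : n ≠ 0) :
    (tensorMap (conjMap (codeFilter m n)) (conjMap (codeFilter m n))
      (tensorPower (isotropic x y) (m * n))).trace =
      ((2 * (2 * ((x + y) ^ n + x ^ n + y ^ n)) ^ m +
        2 * (2 * ((x + y) ^ n + x ^ n - y ^ n)) ^ m : ℝ) : ℂ) := by
  simp only [Matrix.trace, Matrix.diag, tensorMap_codeFilter_apply,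
    tensorMap_hadamard_isotropic_pow x y hn, Fintype.sum_prod_type, Fin.sum_univ_two,
    Matrix.of_apply]
  simp
  ring

theorem trace_phiPlus_mul_codeFilter_isotropic (x y : ℝ) {m n : ℕ} (hn : n ≠ 0) :
    (phiPlus 2 * tensorMap (conjMap (codeFilter m n)) (conjMap (codeFilter m n))
      (tensorPower (isotropic x y) (m * n))).trace =
      (((2 * ((x + y) ^ n + x ^ n + y ^ n)) ^ m +
        (2 * ((x + y) ^ n - x ^ n + y ^ n)) ^ m : ℝ) : ℂ) := by
  simp only [Matrix.trace, Matrix.diag, Matrix.mul_apply, phiPlus_two_apply,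
    tensorMap_codeFilter_apply,
    tensorMap_hadamard_isotropic_pow x y hn, Fintype.sum_prod_type, Fin.sum_univ_two,
    Matrix.of_apply]
  simp
  ring

/-- With `α, β, γ` the `n`-th powers of `x + y`, `x`, `y`, put `r = γ/(α+β+γ)` and `w = β/(α+β+γ)`.
After division by the leading term one needs `(1-2r)^m` small and `(1-2w)^m` near `1`. Taking `m` of
order `1/(εr)` gives the first, and then `mw = mr(x/y)^n` is small for large `n`, precisely because
`x < y`. -/
theorem exists_code_parameters {x y ε : ℝ} (hx : 0 ≤ x) (hxy : x < y) (hε : 0 < ε) :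
    ∃ n m : ℕ, n ≠ 0 ∧
      (2 * ((x + y) ^ n + x ^ n + y ^ n)) ^ m - (2 * ((x + y) ^ n - x ^ n + y ^ n)) ^ m +
        2 * (2 * ((x + y) ^ n + x ^ n - y ^ n)) ^ m ≤
      2 * ε * (2 * ((x + y) ^ n + x ^ n + y ^ n)) ^ m := by
  have hy : 0 < y := hx.trans_lt hxy
  -- The bound is chosen against `mr ≤ 1/ε + 1`, so that `2mw ≤ ε`. It must precede `m`, which
  -- depends on `n` through `r`.
  obtain ⟨n₀, hn₀⟩ := exists_pow_lt_of_lt_one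
    (show 0 < ε / (2 * (1 / ε + 1)) by positivity) ((div_lt_one hy).mpr hxy)
  set n := n₀ + 1 with hn
  have hr1 : (x / y) ^ n ≤ ε / (2 * (1 / ε + 1)) := by
    refine le_trans ?_ hn₀.le
    exact pow_le_pow_of_le_one (by positivity) ((div_lt_one hy).mpr hxy).le (Nat.le_succ _)
  set α := (x + y) ^ n
  set β := x ^ n with hβ
  set γ := y ^ n with hγ
  have hβ0 : 0 ≤ β := by positivity
  have hγ0 : 0 < γ := by positivity
  have hα : γ ≤ α := pow_le_pow_left₀ hy.le (by linarith) n
  have hs : 0 < α + β + γ := by linarith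
  set r := γ / (α + β + γ) with hr
  have hr0 : 0 < r := by positivity
  have hr2 : r ≤ 1 / 2 := by rw [hr, div_le_iff₀ hs]; linarith
  set w := β / (α + β + γ) with hw
  have hw0 : 0 ≤ w := by positivity
  have hwr : w = r * (x / y) ^ n := by
    rw [hw, hr, div_pow, ← hβ, ← hγ]; field_simp
  have hw1 : w ≤ 1 := by rw [hw, div_le_one hs]; linarith
  refine ⟨n, ⌈1 / ε / r⌉₊, by omega, ?_⟩
  set m := ⌈1 / ε / r⌉₊ with hm
  have hm1 : 1 / ε ≤ m * r := by
    have := Nat.le_ceil (1 / ε / r)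
    rwa [div_le_iff₀ hr0] at this
  have hm2 : m * r ≤ 1 / ε + 1 := by
    have h := Nat.ceil_lt_add_one (show 0 ≤ 1 / ε / r by positivity)
    have h2 : (m : ℝ) * r ≤ (1 / ε / r + 1) * r := by gcongr
    rw [add_mul, div_mul_cancel₀ _ hr0.ne'] at h2
    linarith
  set A := 2 * (α + β + γ) with hA
  have hA0 : 0 < A := by positivity
  have hC : 2 * (α - β + γ) = A * (1 + (-2 * w)) := by rw [hw, hA]; field_simp; ring
  have hB : 2 * (α + β - γ) = A * (1 - 2 * r) := by rw [hr, hA]; field_simp; ring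
  rw [hC, hB, mul_pow A (1 + _), mul_pow A (1 - _)]
  have hv : 1 + m * (-2 * w) ≤ (1 + (-2 * w)) ^ m := one_add_mul_le_pow (by linarith) m
  have hmw : 2 * (m * w) ≤ ε := by
    have hmwr : m * w = m * r * (x / y) ^ n := by rw [hwr]; ring
    rw [hmwr]
    calc 2 * (m * r * (x / y) ^ n) ≤ 2 * ((1 / ε + 1) * (ε / (2 * (1 / ε + 1)))) := by gcongr
      _ = ε := by field_simp
  -- From `(1-2r)(1+2r) ≤ 1` and Bernoulli, `(1-2r)^m ≤ 1/(1+2mr) ≤ ε/2`.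
  have hu : 2 * (1 - 2 * r) ^ m ≤ ε := by
    have h1 : (1 - 2 * r) ^ m * (1 + 2 * r) ^ m ≤ 1 := by
      rw [← mul_pow]
      exact pow_le_one₀ (mul_nonneg (by linarith) (by linarith)) (by nlinarith [sq_nonneg r])
    have h2 : 1 + m * (2 * r) ≤ (1 + 2 * r) ^ m := one_add_mul_le_pow (by linarith) m
    have h3 : 0 ≤ (1 - 2 * r) ^ m := pow_nonneg (by linarith) m
    have h4 : (1 - 2 * r) ^ m * (2 * (1 / ε)) ≤ 1 :=
      (mul_le_mul_of_nonneg_left (by linarith) h3).trans h1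
    rw [← mul_assoc, mul_one_div, div_le_one hε] at h4
    linarith
  have hAm : 0 < A ^ m := by positivity
  have : A ^ m * (1 - (1 + (-2 * w)) ^ m + 2 * (1 - 2 * r) ^ m) ≤ A ^ m * (2 * ε) := by
    refine mul_le_mul_of_nonneg_left ?_ hAm.le
    linarith
  linarith

/-- Isotropic states beyond the separability threshold can be filtered to fidelity close to one. -/
theorem exists_filter_isotropic {x y ε : ℝ} (hx : 0 ≤ x) (hxy : x < y) (hε : 0 < ε) :
    ∃ (N : ℕ) (K : Matrix (Fin 2) (Fin N → Fin 2) ℂ), (1 - Kᴴ * K).PosSemidef ∧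
      ∃ t f : ℝ, 0 < t ∧
        (tensorMap (conjMap K) (conjMap K) (tensorPower (isotropic x y) N)).trace = t ∧
        (phiPlus 2 * tensorMap (conjMap K) (conjMap K)
          (tensorPower (isotropic x y) N)).trace = f ∧ t - f ≤ ε * t := by
  obtain ⟨n, m, hn, hnm⟩ := exists_code_parameters hx hxy hε
  obtain ⟨s, hs, hK⟩ := exists_smul_contraction (codeFilter m n)
  -- Each party's filter acts on both sides of `X`, so `s` enters four times.
  have hscale : ∀ X, tensorMap (conjMap ((s : ℂ) • codeFilter m n))
      (conjMap ((s : ℂ) • codeFilter m n)) X = ((s ^ 4 : ℝ) : ℂ) •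
        tensorMap (conjMap (codeFilter m n)) (conjMap (codeFilter m n)) X := by
    intro X
    simp only [tensorMap_conjMap, conjMap_apply, smul_kronecker, kronecker_smul, smul_smul,
      conjTranspose_smul, Matrix.smul_mul, Matrix.mul_smul, star_mul', RCLike.star_def,
      Complex.conj_ofReal]
    congr 1
    push_cast
    ring
  have hy : 0 < y := hx.trans_lt hxy
  have hs4 : 0 < s ^ 4 := by positivity
  have hB : 0 ≤ (2 * ((x + y) ^ n + x ^ n - y ^ n)) ^ m := by
    have := pow_le_pow_left₀ hy.le (show y ≤ x + y by linarith) n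
    have := pow_nonneg hx n
    exact pow_nonneg (by linarith) m
  refine ⟨m * n, (s : ℂ) • codeFilter m n, hK,
    s ^ 4 * (2 * (2 * ((x + y) ^ n + x ^ n + y ^ n)) ^ m +
      2 * (2 * ((x + y) ^ n + x ^ n - y ^ n)) ^ m),
    s ^ 4 * ((2 * ((x + y) ^ n + x ^ n + y ^ n)) ^ m +
      (2 * ((x + y) ^ n - x ^ n + y ^ n)) ^ m), by positivity, ?_, ?_, ?_⟩
  · rw [hscale, trace_smul, trace_codeFilter_isotropic x y hn, smul_eq_mul, ← Complex.ofReal_mul]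
  · rw [hscale, Matrix.mul_smul, trace_smul, trace_phiPlus_mul_codeFilter_isotropic x y hn,
      smul_eq_mul, ← Complex.ofReal_mul]
  · have := mul_le_mul_of_nonneg_left hnm hs4.le
    have := mul_nonneg hε.le (mul_nonneg hs4.le hB)
    linarith

theorem isotropic_isState {x y : ℝ} (hx : 0 ≤ x) (hy : 0 ≤ y) (h1 : 4 * x + 2 * y = 1) :
    IsState (isotropic x y) := by
  constructor
  · exact (PosSemidef.one.smul (by exact_mod_cast hx)).add
      ((phiPlus_posSemidef 2).smul (by exact_mod_cast (by positivity : 0 ≤ 2 * y)))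
  · rw [isotropic, trace_add, trace_smul, trace_smul, trace_phiPlus_two, trace_one]
    simp only [Fintype.card_prod, Fintype.card_fin, smul_eq_mul, mul_one]
    have : ((4 * x + 2 * y : ℝ) : ℂ) = 1 := by rw [h1]; simp
    push_cast at this ⊢
    linear_combination this

/-- Repeating a filter until it succeeds. -/
theorem exists_loccReaches_repeat {ω : Matrix (Fin 2 × Fin 2) (Fin 2 × Fin 2) ℂ} (hω : IsState ω)
    {N : ℕ} {K : Matrix (Fin 2) (Fin N → Fin 2) ℂ} (hK : (1 - Kᴴ * K).PosSemidef) {t f ε : ℝ}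
    (ht : (tensorMap (conjMap K) (conjMap K) (tensorPower ω N)).trace = t)
    (hf : (phiPlus 2 * tensorMap (conjMap K) (conjMap K) (tensorPower ω N)).trace = f)
    (hε : 0 ≤ ε) (htf : t - f ≤ ε * t) (ht1 : t ≤ 1) (r M : ℕ) :
    ∃ D, LOCCReaches ω (N * M + r) D ∧ IsState D ∧
      1 - (phiPlus 2 * D).trace.re ≤ ε + (1 - t) ^ M := by
  induction M with
  | zero =>
    have hP : (Matrix.single (0, 0) (0, 0) 1 :
        Matrix (Fin 2 × Fin 2) (Fin 2 × Fin 2) ℂ).PosSemidef := by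
      rw [← diagonal_single]
      refine PosSemidef.diagonal fun i => ?_
      by_cases h : i = (0, 0)
      · subst h; simp
      · simp [h]
    refine ⟨Matrix.single (0, 0) (0, 0) 1, loccReaches_discard hω.2 _, ⟨hP, by simp⟩, ?_⟩
    -- With no blocks the claimed error is at least `(1-t)^0 = 1`, so nonnegative fidelity suffices.
    have := (Complex.le_def.mp (trace_mul_nonneg (phiPlus_posSemidef 2) hP)).1
    simp only [Complex.zero_re] at this
    rw [pow_zero]
    linarith
  | succ M ih =>
    obtain ⟨D, hD, hDs, hDf⟩ := ih
    have hstep := hD.filter_step hω.2 hK hK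
    have hidx : N + (N * M + r) = N * (M + 1) + r := by ring
    rw [hidx] at hstep
    have h1t : (0 : ℂ) ≤ 1 - t := by exact_mod_cast sub_nonneg.mpr ht1
    refine ⟨_, hstep, ⟨?_, ?_⟩, ?_⟩
    · rw [ht]
      exact (tensorMap_conjMap_posSemidef K K (tensorPower_posSemidef hω.1 N)).add
        (hDs.1.smul h1t)
    · rw [trace_add, trace_smul, ht, hDs.2, smul_eq_mul]
      ring
    · rw [mul_add, Matrix.mul_smul, trace_add, trace_smul, hf, ht, smul_eq_mul]
      have : ((f : ℂ) + (1 - t) * (phiPlus 2 * D).trace).re =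
          f + (1 - t) * (phiPlus 2 * D).trace.re := by
        simp
      rw [this, pow_succ]
      -- The new infidelity is `(t - f) + (1-t)(1 - F) ≤ εt + (1-t)(ε + (1-t)^M) = ε + (1-t)^(M+1)`,
      -- where `F` is the fidelity of `D`.
      have := mul_le_mul_of_nonneg_left hDf (sub_nonneg.mpr ht1)
      nlinarith

/-- Two-qubit isotropic states beyond the separability threshold are distillable. -/
theorem isLOCCDistillable_isotropic {x y : ℝ} (hx : 0 ≤ x) (hxy : x < y)
    (h1 : 4 * x + 2 * y = 1) : IsLOCCDistillable (isotropic x y) := by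
  have hω := isotropic_isState hx (hx.trans hxy.le) h1
  refine exists_seq_tendsto_zero (P := fun n Λ => IsLOCC Λ)
    (f := fun n Λ => traceNorm (Λ (tensorPower (isotropic x y) n) - phiPlus 2)) (fun n => ?_)
    (fun n Λ => traceNorm_nonneg _) fun ε hε => ?_
  · obtain ⟨Λ, hΛ, -⟩ := loccReaches_discard hω.2 n
    exact ⟨Λ, hΛ⟩
  -- Filter error and failure probability each cost at most `δ`, and `8(δ + δ) = ε²`.
  · set δ := ε ^ 2 / 16 with hδ
    have hδ0 : 0 < δ := by positivity
    obtain ⟨N, K, hK, t, f, ht0, ht, hf, htf⟩ := exists_filter_isotropic hx hxy hδ0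
    have ht1 : t ≤ 1 := by
      have := trace_tensorMap_conjMap_le hK hK (tensorPower_posSemidef hω.1 N)
      rw [ht, trace_tensorPower, hω.2, one_pow] at this
      exact_mod_cast this
    obtain ⟨M, hM⟩ := exists_pow_lt_of_lt_one hδ0 (show 1 - t < 1 by linarith)
    filter_upwards [eventually_ge_atTop (N * M)] with n hn
    obtain ⟨r, rfl⟩ := Nat.exists_eq_add_of_le hn
    obtain ⟨D, ⟨Λ, hΛ, hΛD⟩, hDs, hDf⟩ :=
      exists_loccReaches_repeat hω hK ht hf hδ0.le htf ht1 r M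
    refine ⟨Λ, hΛ, ?_⟩
    rw [hΛD]
    have h := traceNorm_sub_phiPlus_sq_le hDs
    refine le_of_sq_le_sq ?_ hε.le
    rw [hδ] at hM hDf
    linarith

end QEnt

end

/-! ### The main theorem -/

open QEnt
theorem mainTheorem1 {a b : Type*} [Fintype a] [DecidableEq a] [Fintype b] [DecidableEq b]
    (ρ : Matrix (a × b) (a × b) ℂ) (hρ : IsNPTState ρ) :
    (∃ η : a × b → ℂ, IsNegativeUnitEigenvector (partialTranspose ρ) η) ∧
    ∀ η : a × b → ℂ, IsNegativeUnitEigenvector (partialTranspose ρ) η →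
      IsChannel (measurePrepare (testOperator η)) ∧
      IsDuallyNonEntangling (measurePrepare (testOperator η)) ∧
      IsPPTMap (measurePrepare (testOperator η)) ∧
      IsEntangledState (measurePrepare (testOperator η) ρ) ∧
      IsLOCCDistillable (measurePrepare (testOperator η) ρ) := by
  obtain ⟨⟨hρ, hρ1⟩, hNPT⟩ := hρ
  refine ⟨exists_isNegativeUnitEigenvector (partialTranspose_isHermitian hρ.isHermitian) hNPT, ?_⟩
  rintro η ⟨hη, μ, hμ, hημ⟩
  have hA := (isSeparable_testOperator hη).posSemidef
  have hA' := posSemidef_one_sub_testOperator hη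
  have hW : (witness η * ρ).trace = μ := by
    rw [trace_witness_mul, hημ, dotProduct_smul, hη, smul_eq_mul, mul_one]
  have hα : (testOperator η * ρ).trace = (((μ + 2) / 3 : ℝ) : ℂ) := by
    rw [trace_testOperator_mul, hW, hρ1]; push_cast; ring
  have hβ : ((1 - testOperator η) * ρ).trace = (((1 - μ) / 3 : ℝ) : ℂ) := by
    rw [trace_one_sub_testOperator_mul, hW, hρ1]; push_cast; ring
  -- Positivity of `A` forces `μ ≥ -2`, so the noise weight `x = (μ+2)/12` of the output is
  -- nonnegative.
  have hα0 : 0 ≤ (μ + 2) / 3 := by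
    have := trace_mul_nonneg hA hρ
    rw [hα] at this
    exact_mod_cast this
  have hout : measurePrepare (testOperator η) ρ = (((μ + 2) / 12 : ℝ) : ℂ) • 1 +
      (2 * ((1 - μ) / 6 : ℝ) : ℂ) • phiPlus 2 := by
    rw [measurePrepare_apply, hα, hβ]
    push_cast
    module
  have hstate : IsState (measurePrepare (testOperator η) ρ) := by
    refine ⟨?_, by rw [measurePrepare_isTracePreserving, hρ1]⟩
    rw [measurePrepare_apply]
    exact ((PosSemidef.one.smul (by positivity)).smul (trace_mul_nonneg hA hρ)).add
      ((phiPlus_posSemidef 2).smul (trace_mul_nonneg hA' hρ))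
  refine ⟨⟨measurePrepare_isCompletelyPositive hA hA', measurePrepare_isTracePreserving⟩,
    ⟨measurePrepare_testOperator_isNonEntangling hη,
      dualMap_measurePrepare_testOperator_isNonEntangling hη⟩,
    measurePrepare_testOperator_isPPTMap hη, ⟨hstate, fun hsep => ?_⟩, ?_⟩
  -- Separability would force fidelity at most `1/2`, but here `1 - 2·fidelity = μ/2 < 0`.
  · have h := hsep.two_mul_trace_phiPlus_mul_le
    rw [hstate.2, hout, mul_add, trace_add, Matrix.mul_smul, Matrix.mul_smul, mul_one,
      phiPlus_two_mul_self, trace_smul, trace_smul, trace_phiPlus_two] at h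
    have h' : (0 : ℝ) ≤ 1 - 2 * ((μ + 2) / 12 + 2 * ((1 - μ) / 6)) := by
      simp only [smul_eq_mul, mul_one] at h
      exact_mod_cast h
    linarith
  · rw [hout]
    exact isLOCCDistillable_isotropic (x := (μ + 2) / 12) (y := (1 - μ) / 6) (by linarith)
      (by linarith) (by linarith)
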